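/- A convex body in $\mathbb{R}^n$ is a compact convex set with non-empty interior. Let $1\le k\le n$, let $u\in\mathbb{R}^n$ be a unit vector and let $E\subset u^\perp$ be a linear subspace of dimension $k-1$. For $x\in\mathbb{R}^n$ and a compact $K\subset\mathbb{R}^n$ put $|P_{E\wedge x}K|:=|P_{E^\perp}x|\cdot|P_{\mathrm{span}(E,x)}K|$, where $P_F$ is orthogonal projection onto $F$ and $|P_FK|$ is the Lebesgue measure of $P_FK$ in $F$ (of dimension $\dim F$), and put $$L_E(K):=\{x\in E^\perp : |P_{E\wedge x}K|\le 1\},\qquad L_{E,u,s}(K):=\{y\in E^\perp\cap u^\perp : |P_{E\wedge(y+su)}K|\le 1\}\quad(s\in\mathbb{R}).$$ For $t\in\mathbb{R}$ let $T_t:\mathbb{R}^{n+1}\to\mathbb{R}^n$ be the linear projection onto $\mathbb{R}^n$ parallel to $e_{n+1}+tu$. A family $\{K(t)\}_{t\in\mathbb{R}}$ of convex bodies in $\mathbb{R}^n$ is a shadow system in the direction $u$ if there is a compact convex set $\tilde K\subset\mathbb{R}^{n+1}$ with $K(t)=T_t(\tilde K)$ for all $t$. For a convex body $K$, let $R_uK$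 be its reflection about $u^\perp$, let $S_uK$ be its Steiner symmetral in the direction $u$, and let $K_u(t):=T_t\bigl(T_1^{-1}(K)\cap T_{-1}^{-1}(R_uK)\bigr)$, $t\in\mathbb{R}$. **Theorem.** (a) Let $K$ be a convex body in $\mathbb{R}^n$. Then $\{K_u(t)\}_{t\in\mathbb{R}}$ is a shadow system in the direction $u$, with $K_u(1)=K$, $K_u(0)=S_uK$ and $K_u(-1)=R_uK$. For every $t\in\mathbb{R}$, $$\int_{L_E(K_u(t))}|\langle x,u\rangle|^{k-1}\,dx=\int_{\mathbb{R}}|s|^{k-1}\,|L_{E,u,s}(K_u(t))|\,ds\in(0,\infty),$$ and the function $$\mathbb{R}\ni t\mapsto M_k(L_E(K_u(t))):=\Bigl(\int_{L_E(K_u(t))}|\langle x,u\rangle|^{k-1}\,dx\Bigr)^{-1/k}$$ is convex and even. (b) Let $\{K(t)\}_{t\in\mathbb{R}}$ be any shadow system in the direction $u$. For every $t\in\mathbb{R}$, $$\int_{L_E(K(t))\cap\{\langle x,u\rangle>0\}}\langle x,u\rangle^{k-1}\,dx=\int_0^\infty s^{k-1}\,|L_{E,u,s}(K(t))|\,ds\in(0,\infty),$$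 and the function $$\mathbb{R}\ni t\mapsto\Bigl(\int_{L_E(K(t))\cap\{\langle x,u\rangle>0\}}\langle x,u\rangle^{k-1}\,dx\Bigr)^{-1/k}$$ is convex. Here $dx$ is the Lebesgue measure on $E^\perp$ and $|L_{E,u,s}(\cdot)|$ is the Lebesgue measure in $E^\perp\cap u^\perp$ (counting measure if this space is $\{0\}$). -/

import Mathlib

open MeasureTheory Module
open scoped RealInnerProductSpace

noncomputable section

/-- A convex body in `ℝⁿ`: a compact convex set with non-empty interior. -/
structure IsConvexBody {n : ℕ} (K : Set (EuclideanSpace ℝ (Fin n))) : Prop where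
  isCompact : IsCompact K
  convex : Convex ℝ K
  nonempty_interior : (interior K).Nonempty

/-- The Lebesgue measure of a linear subspace `F` of `ℝⁿ`, with respect to the Euclidean structure
induced from `ℝⁿ` (so of dimension `dim F`; the unit mass at the origin if `F = {0}`).
The instance is named so that it is not confused with the restriction to the subtype `F`
of the `n`-dimensional Lebesgue measure. -/
def lebesgueOn {n : ℕ} (F : Submodule ℝ (EuclideanSpace ℝ (Fin n))) : Measure F :=
  @volume F measureSpaceOfInnerProductSpace

/-- `|P_F K|`: the Lebesgue measure in `F` of the orthogonal projection of `K` onto `F`. -/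
def projVol {n : ℕ} (F : Submodule ℝ (EuclideanSpace ℝ (Fin n)))
    (K : Set (EuclideanSpace ℝ (Fin n))) : ℝ :=
  (lebesgueOn F).real (F.orthogonalProjectionOnto '' K)

/-- `|P_{E ∧ x} K| = |P_{E^⊥} x| |P_{span(E, x)} K|`. -/
def wedgeVol {n : ℕ} (E : Submodule ℝ (EuclideanSpace ℝ (Fin n)))
    (x : EuclideanSpace ℝ (Fin n)) (K : Set (EuclideanSpace ℝ (Fin n))) : ℝ :=
  ‖Eᗮ.orthogonalProjectionOnto x‖ * projVol (E ⊔ Submodule.span ℝ {x}) K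

/-- The `E`-projected polar body `L_E(K) = {x ∈ E^⊥ ; |P_{E ∧ x} K| ≤ 1}`, as a subset of the
Euclidean space `E^⊥`. -/
def projPolar {n : ℕ} (E : Submodule ℝ (EuclideanSpace ℝ (Fin n)))
    (K : Set (EuclideanSpace ℝ (Fin n))) : Set Eᗮ :=
  {x | wedgeVol E (x : EuclideanSpace ℝ (Fin n)) K ≤ 1}

/-- The section `L_{E,u,s}(K) = {y ∈ E^⊥ ∩ u^⊥ ; |P_{E ∧ (y + s u)} K| ≤ 1}`, as a subset of the
Euclidean space `E^⊥ ∩ u^⊥`. -/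
def projPolarSection {n : ℕ} (E : Submodule ℝ (EuclideanSpace ℝ (Fin n)))
    (u : EuclideanSpace ℝ (Fin n)) (s : ℝ) (K : Set (EuclideanSpace ℝ (Fin n))) :
    Set (Eᗮ ⊓ (Submodule.span ℝ {u})ᗮ : Submodule ℝ (EuclideanSpace ℝ (Fin n))) :=
  {y | wedgeVol E ((y : EuclideanSpace ℝ (Fin n)) + s • u) K ≤ 1}

/-- The volume `|L_{E,u,s}(K)|` of the section, in the Euclidean space `E^⊥ ∩ u^⊥`. -/
def sectionVol {n : ℕ} (E : Submodule ℝ (EuclideanSpace ℝ (Fin n)))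
    (u : EuclideanSpace ℝ (Fin n)) (s : ℝ) (K : Set (EuclideanSpace ℝ (Fin n))) : ℝ :=
  (lebesgueOn (Eᗮ ⊓ (Submodule.span ℝ {u})ᗮ)).real (projPolarSection E u s K)

/-- The two-sided moment `∫_L |⟨x, u⟩|^{k-1} dx` of a set `L ⊆ E^⊥`. -/
def moment {n : ℕ} (k : ℕ) (u : EuclideanSpace ℝ (Fin n))
    (E : Submodule ℝ (EuclideanSpace ℝ (Fin n))) (L : Set Eᗮ) : ℝ :=
  ∫ x in L, |⟪(x : EuclideanSpace ℝ (Fin n)), u⟫| ^ (k - 1) ∂(lebesgueOn Eᗮ)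

/-- The part `{x ∈ L ; ⟨x, u⟩ > 0}` of a set `L ⊆ E^⊥`. -/
def positivePart {n : ℕ} (u : EuclideanSpace ℝ (Fin n))
    (E : Submodule ℝ (EuclideanSpace ℝ (Fin n))) (L : Set Eᗮ) : Set Eᗮ :=
  {x | x ∈ L ∧ 0 < ⟪(x : EuclideanSpace ℝ (Fin n)), u⟫}

/-- The one-sided moment `∫_L ⟨x, u⟩_+^{k-1} dx` of a set `L ⊆ E^⊥`. The domain is cut down to
`⟨x, u⟩ > 0`, which for `k = 1` amounts to reading `a_+^0` as the indicator of `a > 0`. -/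
def momentPos {n : ℕ} (k : ℕ) (u : EuclideanSpace ℝ (Fin n))
    (E : Submodule ℝ (EuclideanSpace ℝ (Fin n))) (L : Set Eᗮ) : ℝ :=
  ∫ x in positivePart u E L, ⟪(x : EuclideanSpace ℝ (Fin n)), u⟫ ^ (k - 1) ∂(lebesgueOn Eᗮ)

/-- `T_t : ℝⁿ⁺¹ → ℝⁿ`, the linear projection onto `ℝⁿ` parallel to `e_{n+1} + t u`, with
`ℝⁿ⁺¹` written as `ℝⁿ × ℝ`: it fixes `(x, 0)` and kills `(t u, 1)`. -/
def shadowProj {n : ℕ} (u : EuclideanSpace ℝ (Fin n)) (t : ℝ)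
    (p : EuclideanSpace ℝ (Fin n) × ℝ) : EuclideanSpace ℝ (Fin n) :=
  p.1 - (t * p.2) • u

/-- A shadow system in the direction `u`: a family of convex bodies `K(t) = T_t(K')`, `t ∈ ℝ`, for
some compact convex set `K' ⊆ ℝⁿ⁺¹`. -/
def IsShadowSystem {n : ℕ} (u : EuclideanSpace ℝ (Fin n))
    (K : ℝ → Set (EuclideanSpace ℝ (Fin n))) : Prop :=
  (∀ t, IsConvexBody (K t)) ∧
    ∃ K' : Set (EuclideanSpace ℝ (Fin n) × ℝ), IsCompact K' ∧ Convex ℝ K' ∧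
      ∀ t, K t = shadowProj u t '' K'

/-- `R_u K`: the reflection of `K` about the hyperplane `u^⊥`. -/
def reflect {n : ℕ} (u : EuclideanSpace ℝ (Fin n)) (K : Set (EuclideanSpace ℝ (Fin n))) :
    Set (EuclideanSpace ℝ (Fin n)) :=
  ((Submodule.span ℝ {u})ᗮ).reflection '' K

/-- The Steiner symmetral `S_u K` (for a unit vector `u`): every non-empty section of `K` by a line
parallel to `u` is replaced by the closed segment on that line that is symmetric about `u^⊥` and has
the same length. -/
def steiner {n : ℕ} (u : EuclideanSpace ℝ (Fin n)) (K : Set (EuclideanSpace ℝ (Fin n))) :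
    Set (EuclideanSpace ℝ (Fin n)) :=
  {x | (∃ a : ℝ, x + a • u ∈ K) ∧ |⟪x, u⟫| ≤ volume.real {a : ℝ | x + a • u ∈ K} / 2}

/-- The linear shadow system `K_u(t) = T_t(T_1⁻¹(K) ∩ T_{-1}⁻¹(R_u K))`. -/
def linearShadow {n : ℕ} (u : EuclideanSpace ℝ (Fin n)) (K : Set (EuclideanSpace ℝ (Fin n)))
    (t : ℝ) : Set (EuclideanSpace ℝ (Fin n)) :=
  shadowProj u t '' (shadowProj u 1 ⁻¹' K ∩ shadowProj u (-1) ⁻¹' reflect u K)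

end

/-! For x in E^⊥, |P_{E ∧ x} K| is the volume of {(P_E z, ⟨z, x⟩) : z ∈ K}. The fibre of this set
over a point of E is an interval whose length is the oscillation of ⟨·, x⟩ on a slice of K, so the
volume is a seminorm in x. For a shadow system K(t) = T_t(K'), P_E ignores the shift along u, and
for y ⊥ u one has ⟨T_t(z, r), y + u⟩ = ⟨z, y + u⟩ - t r, which is affine in (y, t). Hence φ(y, t) =
|P_{E ∧ (y + u)} K(t)| is jointly convex (`convexOn_wedgeVol_shadow`).

Let d = dim(E^⊥ ∩ u^⊥). By homogeneity, the one-sided moment of L_E(K(t)) equals (d + k)⁻¹ ∫ φ(y,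
t)^{-(d+k)} dy (`integral_pow_mul_measure_slice`). The Borell-Brascamp-Lieb inequality
(`convexOn_integral_inv_pow_euclidean`) then says that the power -1/k of this integral is convex in
t, which is (b). It is proved one coordinate at a time: the one-dimensional case combines the
layer-cake formula, Brunn-Minkowski for intervals and Jensen's inequality.

For (a), L_E(K) is centrally symmetric, so its two-sided moment is twice the one-sided one. Evenness
follows from K_u(-t) = R_u K_u(t) and the invariance of the section volumes under R_u. -/

noncomputable section

/-! ### Intervals, integrability and the layer-cake formula -/

/-- The length of a non-empty compact convex set of reals is its diameter. -/
theorem volume_eq_ediam_of_convex {S : Set ℝ} (hS : Convex ℝ S) (hc : IsCompact S) :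
    volume S = Metric.ediam S := by
  rcases S.eq_empty_or_nonempty with rfl | hne
  · simp
  · rw [Real.ediam_eq hc.isBounded]
    conv_lhs => rw [eq_Icc_of_connected_compact ⟨hne, hS.isPreconnected⟩ hc]
    exact Real.volume_Icc

/-- The one-dimensional Brunn-Minkowski inequality for compact intervals. -/
theorem volume_add_le_of_convex {S₀ S₁ T : Set ℝ} (h₀ : Convex ℝ S₀) (hc₀ : IsCompact S₀)
    (hn₀ : S₀.Nonempty) (h₁ : Convex ℝ S₁) (hc₁ : IsCompact S₁) (hn₁ : S₁.Nonempty)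
    (hT : Convex ℝ T) {a b : ℝ} (ha : 0 ≤ a) (hb : 0 ≤ b)
    (h : ∀ x ∈ S₀, ∀ y ∈ S₁, a * x + b * y ∈ T) :
    ENNReal.ofReal a * volume S₀ + ENNReal.ofReal b * volume S₁ ≤ volume T := by
  have e₀ := eq_Icc_of_connected_compact ⟨hn₀, h₀.isPreconnected⟩ hc₀
  have e₁ := eq_Icc_of_connected_compact ⟨hn₁, h₁.isPreconnected⟩ hc₁
  have l₀ : sInf S₀ ≤ sSup S₀ := Set.nonempty_Icc.1 (e₀ ▸ hn₀)
  have l₁ : sInf S₁ ≤ sSup S₁ := Set.nonempty_Icc.1 (e₁ ▸ hn₁)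
  have hsub : Set.Icc (a * sInf S₀ + b * sInf S₁) (a * sSup S₀ + b * sSup S₁) ⊆ T :=
    hT.ordConnected.out (h _ (hc₀.sInf_mem hn₀) _ (hc₁.sInf_mem hn₁))
      (h _ (hc₀.sSup_mem hn₀) _ (hc₁.sSup_mem hn₁))
  refine le_trans (le_of_eq ?_) (measure_mono hsub)
  rw [Real.volume_Icc]
  conv_lhs => rw [e₀, e₁]
  rw [Real.volume_Icc, Real.volume_Icc, ← ENNReal.ofReal_mul ha, ← ENNReal.ofReal_mul hb,
    ← ENNReal.ofReal_add (mul_nonneg ha (sub_nonneg.2 l₀)) (mul_nonneg hb (sub_nonneg.2 l₁))]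
  congr 1; ring

/-- The bound c(1 + ‖x‖) ≤ f x is the form of coercivity used throughout: it gives integrable
negative powers, compact sublevel sets and an attained minimum, and it survives taking marginals. -/
theorem integrable_inv_pow_of_le {V : Type*} [NormedAddCommGroup V] [NormedSpace ℝ V]
    [FiniteDimensional ℝ V] [MeasurableSpace V] [BorelSpace V] (μ : Measure V) [μ.IsAddHaarMeasure]
    {f : V → ℝ} (hf : Continuous f) {c : ℝ} (hc : 0 < c) (h : ∀ x, c * (1 + ‖x‖) ≤ f x) {p : ℕ}
    (hp : finrank ℝ V < p) : Integrable (fun x => (f x ^ p)⁻¹) μ := by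
  have hpos : ∀ x, 0 < f x := fun x => lt_of_lt_of_le (by positivity) (h x)
  have hi : Integrable (fun x : V => (1 + ‖x‖) ^ (-(p : ℝ))) μ :=
    integrable_one_add_norm (by exact_mod_cast hp)
  refine (hi.const_mul (c ^ p)⁻¹).mono' ?_ (Filter.Eventually.of_forall fun x => ?_)
  · exact ((hf.pow p).inv₀ fun x => (pow_pos (hpos x) p).ne').aestronglyMeasurable
  · rw [Real.norm_of_nonneg (inv_nonneg.2 (pow_pos (hpos x) p).le), Real.rpow_neg (by positivity),
      Real.rpow_natCast, ← mul_inv, ← mul_pow]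
    gcongr
    exact h x

theorem rpow_neg_inv_pow_mul {x : ℝ} (hx : 0 < x) {q : ℕ} (hq : q ≠ 0) :
    (x ^ (-1 / (q : ℝ))) ^ q = x⁻¹ := by
  rw [← Real.rpow_mul_natCast hx.le, div_mul_cancel₀ _ (by exact_mod_cast hq), Real.rpow_neg_one]

theorem inv_pow_rpow_neg_inv {x : ℝ} (hx : 0 < x) {q : ℕ} (hq : q ≠ 0) :
    ((x ^ q)⁻¹) ^ (-1 / (q : ℝ)) = x := by
  rw [Real.inv_rpow (by positivity), ← Real.rpow_natCast, ← Real.rpow_mul hx.le,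
    ← Real.rpow_neg hx.le, show -((q : ℝ) * (-1 / (q : ℝ))) = 1 by field_simp, Real.rpow_one]

/-- This removes the normalising constants mᵢ from the one-dimensional inequality. With bᵢ =
Iᵢ^(-1/q) and B = a b₀ + b b₁, Jensen for x ↦ x^(q+1) at the points mᵢ / bᵢ, with weights a b₀ / B
and b b₁ / B, bounds ((a m₀ + b m₁) / B)^(q+1) by the left side of `h` divided by B; the factor (a
m₀ + b m₁)^(q+1) then cancels. -/
theorem rpow_neg_inv_le_of_le_pow {q : ℕ} (hq : q ≠ 0) {a b m₀ m₁ I₀ I₁ J : ℝ} (ha : 0 < a)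
    (hb : 0 < b) (h₀ : 0 < m₀) (h₁ : 0 < m₁) (hI₀ : 0 < I₀) (hI₁ : 0 < I₁)
    (hJ : 0 < J)
    (h : a * (m₀ ^ (q + 1) * I₀) + b * (m₁ ^ (q + 1) * I₁) ≤ (a * m₀ + b * m₁) ^ (q + 1) * J) :
    J ^ (-1 / (q : ℝ)) ≤ a * I₀ ^ (-1 / (q : ℝ)) + b * I₁ ^ (-1 / (q : ℝ)) := by
  have e₀ := rpow_neg_inv_pow_mul hI₀ hq
  have e₁ := rpow_neg_inv_pow_mul hI₁ hq
  have eJ := rpow_neg_inv_pow_mul hJ hq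
  have p₀ := Real.rpow_pos_of_pos hI₀ (-1 / (q : ℝ))
  have p₁ := Real.rpow_pos_of_pos hI₁ (-1 / (q : ℝ))
  have pJ := Real.rpow_pos_of_pos hJ (-1 / (q : ℝ))
  generalize I₀ ^ (-1 / (q : ℝ)) = b₀ at *
  generalize I₁ ^ (-1 / (q : ℝ)) = b₁ at *
  generalize J ^ (-1 / (q : ℝ)) = c at *
  have f₀ : I₀ = (b₀ ^ q)⁻¹ := by rw [e₀, inv_inv]
  have f₁ : I₁ = (b₁ ^ q)⁻¹ := by rw [e₁, inv_inv]
  have fJ : J = (c ^ q)⁻¹ := by rw [eJ, inv_inv]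
  subst f₀ f₁ fJ
  set B := a * b₀ + b * b₁ with hB
  have pB : 0 < B := by positivity
  have hcp : ConvexOn ℝ (Set.Ici 0) fun x : ℝ => x ^ (q + 1) := convexOn_pow (q + 1)
  have hj := hcp.2 (x := m₀ / b₀) (y := m₁ / b₁)
    (Set.mem_Ici.2 (by positivity)) (Set.mem_Ici.2 (by positivity))
    (show 0 ≤ a * b₀ / B by positivity) (show 0 ≤ b * b₁ / B by positivity)
    (by rw [← add_div, div_self pB.ne'])
  simp only [smul_eq_mul] at hj
  have s₁ : a * b₀ / B * (m₀ / b₀) + b * b₁ / B * (m₁ / b₁) = (a * m₀ + b * m₁) / B := by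
    field_simp
  have s₂ : a * b₀ / B * (m₀ / b₀) ^ (q + 1) + b * b₁ / B * (m₁ / b₁) ^ (q + 1)
      = (a * (m₀ ^ (q + 1) * (b₀ ^ q)⁻¹) + b * (m₁ ^ (q + 1) * (b₁ ^ q)⁻¹)) / B := by
    rw [div_pow, div_pow]
    field_simp
    ring
  rw [s₁, s₂, div_pow, le_div_iff₀ pB] at hj
  have hM : 0 < (a * m₀ + b * m₁) ^ (q + 1) := by positivity
  have h' := hj.trans h
  have : (a * m₀ + b * m₁) ^ (q + 1) / B ^ (q + 1) * B
      = (a * m₀ + b * m₁) ^ (q + 1) * (B ^ q)⁻¹ := by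
    field_simp
    ring
  rw [this, mul_le_mul_iff_right₀ hM, inv_le_inv₀ (by positivity) (by positivity)] at h'
  exact le_of_pow_le_pow_left₀ hq pB.le h'

/-- The layer-cake formula with natural exponents. It serves both the one-dimensional inequality and
the passage from slices to an integral of a negative power. -/
theorem lintegral_pow_eq_lintegral_meas_le {α : Type*} [MeasurableSpace α] (μ : Measure α)
    {f : α → ℝ} (hf : ∀ x, 0 ≤ f x) (hm : Measurable f) (q : ℕ) :
    ∫⁻ x, ENNReal.ofReal (f x ^ (q + 1)) ∂μ = ENNReal.ofReal (q + 1) *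
      ∫⁻ s in Set.Ioi (0 : ℝ), μ {x | s ≤ f x} * ENNReal.ofReal (s ^ q) := by
  have := lintegral_rpow_eq_lintegral_meas_le_mul μ (Filter.Eventually.of_forall hf)
    hm.aemeasurable (p := (q : ℝ) + 1) (by positivity)
  simp only [add_sub_cancel_right, Real.rpow_natCast] at this
  rw [← this]
  refine lintegral_congr fun x => ?_
  rw [← Real.rpow_natCast]
  push_cast
  rfl

/-! ### The Borell-Brascamp-Lieb inequality for negative powers of convex functions -/

section OneDim

variable {A : Type*} [AddCommGroup A] [Module ℝ A]

theorem ConvexOn.continuous_fst {V : Type*} [NormedAddCommGroup V] [NormedSpace ℝ V]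
    [FiniteDimensional ℝ V] {φ : V × A → ℝ} (hφ : ConvexOn ℝ Set.univ φ) (a : A) :
    Continuous fun y => φ (y, a) := by
  have : ConvexOn ℝ Set.univ fun y => φ (y, a) := by
    refine ⟨convex_univ, fun x _ y _ s t hs ht hst => ?_⟩
    have := hφ.2 (x := (x, a)) (y := (y, a)) trivial trivial hs ht hst
    simpa [← add_smul, hst] using this
  exact continuousOn_univ.1 (this.continuousOn isOpen_univ)

theorem exists_forall_le_of_le_one_add_norm {V : Type*} [NormedAddCommGroup V] [NormedSpace ℝ V]
    [FiniteDimensional ℝ V] {f : V → ℝ} (hf : Continuous f) {c : ℝ} (hc : 0 < c)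
    (h : ∀ x, c * (1 + ‖x‖) ≤ f x) : ∃ x, ∀ y, f x ≤ f y := by
  refine hf.exists_forall_le (Filter.tendsto_atTop_mono h ?_)
  exact (Filter.tendsto_atTop_add_const_left _ _ tendsto_norm_cocompact_atTop).const_mul_atTop hc

theorem isCompact_sublevel_of_le_one_add_norm {V : Type*} [NormedAddCommGroup V] [NormedSpace ℝ V]
    [FiniteDimensional ℝ V] {f : V → ℝ} (hf : Continuous f) {c : ℝ} (hc : 0 < c)
    (h : ∀ x, c * (1 + ‖x‖) ≤ f x) (M : ℝ) : IsCompact {x | f x ≤ M} := by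
  refine Metric.isCompact_of_isClosed_isBounded (isClosed_le hf continuous_const)
    ((Metric.isBounded_closedBall (x := (0 : V)) (r := M / c)).subset fun x hx => ?_)
  rw [mem_closedBall_zero_iff, le_div_iff₀ hc]
  have := (h x).trans hx
  nlinarith [norm_nonneg x]

theorem integral_inv_pow_pos {V : Type*} [NormedAddCommGroup V] [NormedSpace ℝ V]
    [FiniteDimensional ℝ V] [MeasurableSpace V] [BorelSpace V] (μ : Measure V) [μ.IsAddHaarMeasure]
    {f : V → ℝ} (hf : Continuous f) {c : ℝ} (hc : 0 < c) (h : ∀ x, c * (1 + ‖x‖) ≤ f x) {p : ℕ}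
    (hp : finrank ℝ V < p) : 0 < ∫ x, (f x ^ p)⁻¹ ∂μ := by
  have hpos : ∀ x, 0 < f x := fun x => lt_of_lt_of_le (by positivity) (h x)
  rw [integral_pos_iff_support_of_nonneg (fun x => inv_nonneg.2 (pow_pos (hpos x) p).le)
    (integrable_inv_pow_of_le μ hf hc h hp)]
  have : Function.support (fun x => (f x ^ p)⁻¹) = Set.univ :=
    Set.eq_univ_of_forall fun x => (inv_pos.2 (pow_pos (hpos x) p)).ne'
  rw [this]
  exact isOpen_univ.measure_pos μ Set.univ_nonempty

/-- The one-dimensional Borell-Brascamp-Lieb inequality: marginals of `φ ^ (-(q + 1))` for convex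
`φ` are `-1/q`-concave. -/
theorem convexOn_integral_inv_pow_real {φ : ℝ × A → ℝ} (hφ : ConvexOn ℝ Set.univ φ)
    (hco : ∀ a, ∃ c > 0, ∀ r : ℝ, c * (1 + ‖r‖) ≤ φ (r, a)) {q : ℕ} (hq : q ≠ 0) :
    ConvexOn ℝ Set.univ fun a => (∫ r, (φ (r, a) ^ (q + 1))⁻¹) ^ (-1 / (q : ℝ)) := by
  have hcont := fun a => hφ.continuous_fst a
  have hfin : finrank ℝ ℝ < q + 1 := by rw [finrank_self]; omega
  have hint : ∀ a, Integrable fun r => (φ (r, a) ^ (q + 1))⁻¹ := fun a => by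
    obtain ⟨c, hc, h⟩ := hco a
    exact integrable_inv_pow_of_le _ (hcont a) hc h hfin
  have hIpos : ∀ a, 0 < ∫ r, (φ (r, a) ^ (q + 1))⁻¹ := fun a => by
    obtain ⟨c, hc, h⟩ := hco a
    exact integral_inv_pow_pos _ (hcont a) hc h hfin
  have hpos : ∀ r a, 0 < φ (r, a) := fun r a => by
    obtain ⟨c, hc, h⟩ := hco a
    exact lt_of_lt_of_le (by positivity) (h r)
  have hmin : ∀ a, ∃ x, ∀ y, φ (x, a) ≤ φ (y, a) := fun a => by
    obtain ⟨c, hc, h⟩ := hco a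
    exact exists_forall_le_of_le_one_add_norm (hcont a) hc h
  have hcpt : ∀ a M, IsCompact {r | φ (r, a) ≤ M} := fun a M => by
    obtain ⟨c, hc, h⟩ := hco a
    exact isCompact_sublevel_of_le_one_add_norm (hcont a) hc h M
  have hcvx : ∀ a M, Convex ℝ {r | φ (r, a) ≤ M} := fun a M => by
    intro x hx y hy s t hs ht hst
    have := hφ.2 (x := (x, a)) (y := (y, a)) trivial trivial hs ht hst
    simp only [Prod.smul_mk, Prod.mk_add_mk, ← add_smul, hst, one_smul, smul_eq_mul] at this
    refine this.trans ?_
    calc s * φ (x, a) + t * φ (y, a) ≤ s * M + t * M := by gcongr <;> assumption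
      _ = M := by rw [← add_mul, hst, one_mul]
  -- Layer cake for (m / φ)^(q+1); below, m is the minimum of φ(·, a), so that m / φ has maximum 1.
  have hlc : ∀ a m, 0 ≤ m → ENNReal.ofReal (m ^ (q + 1) * ∫ r, (φ (r, a) ^ (q + 1))⁻¹)
      = ENNReal.ofReal (q + 1) * ∫⁻ s in Set.Ioi (0 : ℝ),
        volume {r | s ≤ m / φ (r, a)} * ENNReal.ofReal (s ^ q) := by
    intro a m hm
    rw [← lintegral_pow_eq_lintegral_meas_le _ (fun r => div_nonneg hm (hpos r a).le)
      (((hcont a).measurable).const_div m), ← integral_const_mul, ofReal_integral_eq_lintegral_ofReal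
      ((hint a).const_mul _) (Filter.Eventually.of_forall fun r =>
        mul_nonneg (pow_nonneg hm _) (inv_nonneg.2 (pow_pos (hpos r a) _).le))]
    simp only [div_eq_mul_inv, mul_pow, inv_pow]
  have hset : ∀ a m s, 0 < s → {r | s ≤ m / φ (r, a)} = {r | φ (r, a) ≤ m / s} := by
    intro a m s hs
    ext r
    simp only [Set.mem_ofPred_eq]
    rw [le_div_iff₀ (hpos r a), le_div_iff₀ hs, mul_comm]
  rw [convexOn_iff_forall_pos]
  refine ⟨convex_univ, fun a₀ _ a₁ _ s t hs ht hst => ?_⟩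
  obtain ⟨x₀, hx₀⟩ := hmin a₀
  obtain ⟨x₁, hx₁⟩ := hmin a₁
  have h₀ := hpos x₀ a₀
  have h₁ := hpos x₁ a₁
  generalize hm₀ : φ (x₀, a₀) = m₀ at *
  generalize hm₁ : φ (x₁, a₁) = m₁ at *
  refine rpow_neg_inv_le_of_le_pow hq hs ht h₀ h₁ (hIpos _) (hIpos _) (hIpos _) ?_
  have hM : 0 < s * m₀ + t * m₁ := by positivity
  have n₀ := mul_nonneg (pow_nonneg h₀.le (q + 1)) (hIpos a₀).le
  have n₁ := mul_nonneg (pow_nonneg h₁.le (q + 1)) (hIpos a₁).le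
  rw [← ENNReal.ofReal_le_ofReal_iff (mul_nonneg (pow_nonneg hM.le _) (hIpos _).le),
    ENNReal.ofReal_add (mul_nonneg hs.le n₀) (mul_nonneg ht.le n₁), ENNReal.ofReal_mul hs.le,
    ENNReal.ofReal_mul ht.le, hlc _ _ h₀.le, hlc _ _ h₁.le, hlc _ _ hM.le,
    mul_left_comm, mul_left_comm (ENNReal.ofReal t), ← mul_add,
    ← lintegral_const_mul' _ _ ENNReal.ofReal_ne_top,
    ← lintegral_const_mul' _ _ ENNReal.ofReal_ne_top]
  -- It suffices to compare the level sets at each height σ.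
  refine mul_le_mul_right ((le_lintegral_add _ _).trans
    (setLIntegral_mono' measurableSet_Ioi fun σ hσ => ?_)) _
  rw [← mul_assoc, ← mul_assoc, ← add_mul]
  refine mul_le_mul_left ?_ _
  have hσ : 0 < σ := hσ
  rw [hset _ _ _ hσ, hset _ _ _ hσ, hset _ _ _ hσ]
  -- After normalisation both level sets at height σ contain their minimisers when σ ≤ 1, so
  -- Brunn-Minkowski applies, and both are empty when σ > 1. Without it, one of them could be empty
  -- while the other is not.
  rcases le_or_gt σ 1 with hσ1 | hσ1
  · refine volume_add_le_of_convex (hcvx _ _) (hcpt _ _) ⟨x₀, ?_⟩ (hcvx _ _) (hcpt _ _) ⟨x₁, ?_⟩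
      (hcvx _ _) hs.le ht.le fun x hx y hy => ?_
    · simp only [Set.mem_ofPred_eq, hm₀]
      exact le_div_self h₀.le hσ hσ1
    · simp only [Set.mem_ofPred_eq, hm₁]
      exact le_div_self h₁.le hσ hσ1
    · have := hφ.2 (x := (x, a₀)) (y := (y, a₁)) trivial trivial hs.le ht.le hst
      simp only [Prod.smul_mk, Prod.mk_add_mk, smul_eq_mul] at this
      refine this.trans ?_
      calc s * φ (x, a₀) + t * φ (y, a₁) ≤ s * (m₀ / σ) + t * (m₁ / σ) := by
            gcongr <;> assumption
        _ = (s * m₀ + t * m₁) / σ := by ring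
  · have e₀ : {r | φ (r, a₀) ≤ m₀ / σ} = ∅ := Set.eq_empty_of_forall_notMem fun r hr =>
      absurd ((hx₀ r).trans hr) (not_le.2 (div_lt_self h₀ hσ1))
    have e₁ : {r | φ (r, a₁) ≤ m₁ / σ} = ∅ := Set.eq_empty_of_forall_notMem fun r hr =>
      absurd ((hx₁ r).trans hr) (not_le.2 (div_lt_self h₁ hσ1))
    simp [e₀, e₁]

end OneDim

/-- Marginals of `φ ^ (-p)` decay like `‖·‖ ^ (1 - p)`. -/
theorem exists_le_integral_inv_pow_rpow {q : ℕ} (hq : q ≠ 0) {c : ℝ} (hc : 0 < c) :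
    ∃ c' > 0, ∀ (R : ℝ) (f : ℝ → ℝ), 1 ≤ R → Continuous f → (∀ r, c * (R + ‖r‖) ≤ f r) →
      c' * R ≤ (∫ r, (f r ^ (q + 1))⁻¹) ^ (-1 / (q : ℝ)) := by
  have hfin : finrank ℝ ℝ < q + 1 := by rw [finrank_self]; omega
  have hg : Continuous fun r : ℝ => c * (1 + ‖r‖) := by fun_prop
  have hC := integral_inv_pow_pos volume hg hc (fun r => le_rfl) hfin
  have hi := integrable_inv_pow_of_le volume hg hc (fun r => le_rfl) hfin
  refine ⟨_, Real.rpow_pos_of_pos hC (-1 / (q : ℝ)), fun R f hR hf h => ?_⟩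
  have hR0 : 0 < R := by linarith
  have hfp : ∀ r, c * (1 + ‖r‖) ≤ f r := fun r => (by gcongr : _ ≤ _).trans (h r)
  have hI := integral_inv_pow_pos volume hf hc hfp hfin
  have hle : ∫ r, (f r ^ (q + 1))⁻¹ ≤
      (R ^ q)⁻¹ * ∫ r : ℝ, ((c * (1 + ‖r‖)) ^ (q + 1))⁻¹ := by
    -- Rescaling r by R turns c(R + |r|) into R times c(1 + |r|); the Jacobian R leaves R^(-q),
    -- whose power -1/q is R.
    have e : ∫ r : ℝ, (R ^ (q + 1))⁻¹ * ((c * (1 + ‖r / R‖)) ^ (q + 1))⁻¹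
        = (R ^ q)⁻¹ * ∫ r : ℝ, ((c * (1 + ‖r‖)) ^ (q + 1))⁻¹ := by
      rw [integral_const_mul,
        Measure.integral_comp_div (fun r : ℝ => ((c * (1 + ‖r‖)) ^ (q + 1))⁻¹) R,
        abs_of_pos hR0, smul_eq_mul, ← mul_assoc]
      congr 1
      field_simp
      ring
    rw [← e]
    refine integral_mono (integrable_inv_pow_of_le volume hf hc hfp hfin)
      ((hi.comp_div hR0.ne').const_mul _) fun r => ?_
    rw [← mul_inv, ← mul_pow]
    have e₂ : R * (c * (1 + ‖r / R‖)) = c * (R + ‖r‖) := by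
      rw [norm_div, Real.norm_of_nonneg hR0.le]
      field_simp
    rw [e₂]
    have := h r
    gcongr
  have e₃ := inv_pow_rpow_neg_inv hR0 hq
  calc _ = ((R ^ q)⁻¹ * ∫ r : ℝ, ((c * (1 + ‖r‖)) ^ (q + 1))⁻¹) ^ (-1 / (q : ℝ)) := by
        rw [Real.mul_rpow (by positivity) hC.le, e₃, mul_comm]
    _ ≤ _ := Real.rpow_le_rpow_of_nonpos hI hle
        (div_nonpos_of_nonpos_of_nonneg (by norm_num) (Nat.cast_nonneg q))

/-- The Borell-Brascamp-Lieb inequality for powers `φ ^ (-(d + k))` of a convex function on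
`ℝ ^ d × A`: the marginal over `ℝ ^ d` is `-1/k`-concave. -/
theorem convexOn_integral_inv_pow (d : ℕ) {k : ℕ} (hk : k ≠ 0) {A : Type*} [AddCommGroup A]
    [Module ℝ A] {φ : (Fin d → ℝ) × A → ℝ} (hφ : ConvexOn ℝ Set.univ φ)
    (hco : ∀ a, ∃ c > 0, ∀ y, c * (1 + ‖y‖) ≤ φ (y, a)) :
    ConvexOn ℝ Set.univ fun a => (∫ y, (φ (y, a) ^ (d + k))⁻¹) ^ (-1 / (k : ℝ)) := by
  induction d generalizing A with
  | zero =>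
    have hpos : ∀ y a, 0 < φ (y, a) := fun y a => by
      obtain ⟨c, hc, h⟩ := hco a
      exact lt_of_lt_of_le (by positivity) (h y)
    -- In dimension 0 the measure is a point mass, and the powers k and -1/k undo each other.
    have e : (fun a => (∫ y, (φ (y, a) ^ (0 + k))⁻¹) ^ (-1 / (k : ℝ))) =
        fun a => φ (0, a) := by
      funext a
      rw [volume_pi, Measure.pi_of_empty _ (0 : Fin 0 → ℝ), integral_dirac, zero_add]
      exact inv_pow_rpow_neg_inv (hpos 0 a) hk
    rw [e]
    refine ⟨convex_univ, fun x _ y _ s t hs ht hst => ?_⟩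
    simpa using hφ.2 (x := (0, x)) (y := (0, y)) trivial trivial hs ht hst
  | succ d ih =>
    have hcont := fun a => hφ.continuous_fst a
    set φ' : ℝ × ((Fin d → ℝ) × A) → ℝ := fun z => φ (Fin.cons z.1 z.2.1, z.2.2) with hφ'
    have hφ'c : ConvexOn ℝ Set.univ φ' := by
      refine ⟨convex_univ, fun x _ y _ s t hs ht hst => ?_⟩
      have := hφ.2 (x := (Fin.cons x.1 x.2.1, x.2.2)) (y := (Fin.cons y.1 y.2.1, y.2.2))
        trivial trivial hs ht hst
      convert! this using 2
      refine Prod.ext (funext fun i => ?_) rfl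
      refine Fin.cases ?_ (fun i => ?_) i <;> simp
    have hnorm : ∀ (r : ℝ) (y : Fin d → ℝ), (1 + ‖y‖) + ‖r‖ ≤
        2 * (1 + ‖(Fin.cons r y : Fin (d + 1) → ℝ)‖) := by
      intro r y
      have h₁ : ‖r‖ ≤ ‖(Fin.cons r y : Fin (d + 1) → ℝ)‖ := by
        simpa using norm_le_pi_norm (Fin.cons r y : Fin (d + 1) → ℝ) 0
      have h₂ : ‖y‖ ≤ ‖(Fin.cons r y : Fin (d + 1) → ℝ)‖ :=
        (pi_norm_le_iff_of_nonneg (norm_nonneg _)).2 fun i => by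
          simpa using norm_le_pi_norm (Fin.cons r y : Fin (d + 1) → ℝ) i.succ
      linarith
    have hlow : ∀ a, ∃ c > 0, ∀ (r : ℝ) (y : Fin d → ℝ),
        c * ((1 + ‖y‖) + ‖r‖) ≤ φ' (r, y, a) := fun a => by
      obtain ⟨c, hc, h⟩ := hco a
      refine ⟨c / 2, by positivity, fun r y => le_trans ?_ (h (Fin.cons r y))⟩
      have := mul_le_mul_of_nonneg_left (hnorm r y) (by positivity : 0 ≤ c / 2)
      linarith
    have hco' : ∀ b : (Fin d → ℝ) × A, ∃ c > 0, ∀ r : ℝ, c * (1 + ‖r‖) ≤ φ' (r, b) := by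
      rintro ⟨y, a⟩
      obtain ⟨c, hc, h⟩ := hlow a
      refine ⟨c, hc, fun r => le_trans ?_ (h r y)⟩
      gcongr
      linarith [norm_nonneg y]
    -- Since d + 1 + k = (d + k) + 1, integrating out the first coordinate with q = d + k gives a
    -- convex ψ on ℝ^d × A with ψ^(-(d+k)) equal to that marginal, which is the integrand required
    -- by the induction hypothesis.
    have hq : d + k ≠ 0 := by omega
    have hψ := convexOn_integral_inv_pow_real hφ'c hco' hq
    -- Coercivity of ψ: with R = 1 + ‖y‖ the marginal bound gives c'(1 + ‖y‖) with c' independent of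
    -- y.
    have := ih hψ fun a => by
      obtain ⟨c, hc, h⟩ := hlow a
      obtain ⟨c', hc', h'⟩ := exists_le_integral_inv_pow_rpow hq hc
      exact ⟨c', hc', fun y => h' _ _ (by linarith [norm_nonneg y])
        (hφ'c.continuous_fst (y, a)) fun r => h r y⟩
    convert! this using 3 with a
    obtain ⟨c, hc, h⟩ := hco a
    have hint := integrable_inv_pow_of_le volume (hcont a) hc h (p := d + 1 + k)
      (by rw [finrank_fin_fun]; omega)
    have mp := (volume_preserving_piFinSuccAbove (fun _ : Fin (d + 1) => ℝ) 0).symm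
    rw [← mp.integrable_comp_emb (MeasurableEquiv.measurableEmbedding _)] at hint
    rw [← mp.integral_comp (MeasurableEquiv.measurableEmbedding _)]
    refine (integral_prod_symm _ hint).trans (integral_congr_ae
      (Filter.Eventually.of_forall fun y => ?_))
    obtain ⟨c, hc, h⟩ := hco' (y, a)
    have hI := integral_inv_pow_pos volume (hφ'c.continuous_fst (y, a)) hc h (p := d + k + 1)
      (by rw [finrank_self]; omega)
    dsimp only
    rw [rpow_neg_inv_pow_mul hI hq, inv_inv]
    refine integral_congr_ae (Filter.Eventually.of_forall fun r => ?_)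
    have e : (MeasurableEquiv.piFinSuccAbove (fun _ : Fin (d + 1) => ℝ) 0).symm (r, y)
        = Fin.cons r y := Fin.insertNth_zero' r y
    dsimp only [hφ', Function.comp_apply]
    rw [e, add_right_comm]

/-- The Borell-Brascamp-Lieb inequality on a Euclidean space. -/
theorem convexOn_integral_inv_pow_euclidean {V : Type*} [NormedAddCommGroup V]
    [InnerProductSpace ℝ V] [FiniteDimensional ℝ V] [MeasurableSpace V] [BorelSpace V] {k : ℕ}
    (hk : k ≠ 0) {A : Type*} [AddCommGroup A] [Module ℝ A] {φ : V × A → ℝ}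
    (hφ : ConvexOn ℝ Set.univ φ) (hco : ∀ a, ∃ c > 0, ∀ y, c * (1 + ‖y‖) ≤ φ (y, a)) :
    ConvexOn ℝ Set.univ fun a => (∫ y, (φ (y, a) ^ (finrank ℝ V + k))⁻¹) ^ (-1 / (k : ℝ)) := by
  let b := stdOrthonormalBasis ℝ V
  have mp : MeasurePreserving (fun x : Fin (finrank ℝ V) → ℝ => b.repr.symm (WithLp.toLp 2 x)) :=
    b.measurePreserving_repr_symm.comp (PiLp.volume_preserving_toLp _)
  have me : MeasurableEmbedding
      (fun x : Fin (finrank ℝ V) → ℝ => b.repr.symm (WithLp.toLp 2 x)) :=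
    (b.repr.symm.toHomeomorph.measurableEmbedding).comp
      (MeasurableEquiv.toLp 2 (Fin (finrank ℝ V) → ℝ)).measurableEmbedding
  -- Only this inequality between the sup norm and the Euclidean norm is needed to transfer
  -- coercivity to coordinates.
  have hn : ∀ x : Fin (finrank ℝ V) → ℝ, ‖x‖ ≤ ‖b.repr.symm (WithLp.toLp 2 x)‖ := fun x => by
    rw [LinearIsometryEquiv.norm_map]
    exact (pi_norm_le_iff_of_nonneg (norm_nonneg _)).2 fun i =>
      PiLp.norm_apply_le (WithLp.toLp 2 x) i
  have := convexOn_integral_inv_pow (finrank ℝ V) hk (A := A)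
    (φ := fun z => φ (b.repr.symm (WithLp.toLp 2 z.1), z.2)) ?_ fun a => ?_
  · convert! this using 3 with a
    exact (mp.integral_comp me fun y => (φ (y, a) ^ (finrank ℝ V + k))⁻¹).symm
  · refine ⟨convex_univ, fun x _ y _ s t hs ht hst => ?_⟩
    have := hφ.2 (x := (b.repr.symm (WithLp.toLp 2 x.1), x.2))
      (y := (b.repr.symm (WithLp.toLp 2 y.1), y.2)) trivial trivial hs ht hst
    simpa using this
  · obtain ⟨c, hc, h⟩ := hco a
    exact ⟨c, hc, fun y => le_trans (by gcongr; exact hn y) (h _)⟩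

/-! ### From volumes of slices to an integral of a negative power -/

open scoped Pointwise in
/-- Integrating the volumes of the slices of the unit ball of a positively homogeneous function
`H` on `V × ℝ` against `s ^ (k - 1)` amounts to integrating `H (·, 1) ^ (-(dim V + k))`. -/
theorem integral_pow_mul_measure_slice {V : Type*} [NormedAddCommGroup V] [NormedSpace ℝ V]
    [FiniteDimensional ℝ V] [MeasurableSpace V] [BorelSpace V] (μ : Measure V) [μ.IsAddHaarMeasure]
    {H : V → ℝ → ℝ} (hH : ∀ y s, 0 < s → H (s • y) s = s * H y 1)
    (hc : Continuous fun y => H y 1) {c : ℝ} (hc0 : 0 < c) (h : ∀ y, c * (1 + ‖y‖) ≤ H y 1)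
    (q : ℕ) :
    ∫ s in Set.Ioi (0 : ℝ), s ^ q * μ.real {y | H y s ≤ 1} =
      (↑(finrank ℝ V + q + 1))⁻¹ * ∫ y, (H y 1 ^ (finrank ℝ V + (q + 1)))⁻¹ ∂μ := by
  have hpos : ∀ y, 0 < H y 1 := fun y => lt_of_lt_of_le (by positivity) (h y)
  have hset : ∀ s, 0 < s → {y | s ≤ (H y 1)⁻¹} = {y | H y 1 ≤ 1 / s} := fun s hs => by
    ext y
    simp only [Set.mem_ofPred_eq]
    rw [le_inv_comm₀ hs (hpos y), one_div]
  have hfin : ∀ s, 0 < s → μ {y | s ≤ (H y 1)⁻¹} ≠ ⊤ := fun s hs => by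
    rw [hset s hs]
    exact (isCompact_sublevel_of_le_one_add_norm hc hc0 h _).measure_ne_top
  -- By homogeneity the slice at height s is the s-dilate of {H(·, 1) ≤ 1/s}; the dilation
  -- contributes s^d, with d = dim V.
  have hslice : ∀ s, 0 < s → μ.real {y | H y s ≤ 1} =
      s ^ finrank ℝ V * μ.real {y | s ≤ (H y 1)⁻¹} := fun s hs => by
    have : {y | H y s ≤ 1} = s • {y | s ≤ (H y 1)⁻¹} := by
      ext y
      rw [Set.mem_smul_set_iff_inv_smul_mem₀ hs.ne', hset s hs]
      simp only [Set.mem_ofPred_eq]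
      have := hH (s⁻¹ • y) s hs
      rw [smul_inv_smul₀ hs.ne'] at this
      rw [this, le_div_iff₀ hs, mul_comm]
    rw [this, measureReal_def, Measure.addHaar_smul, ENNReal.toReal_mul,
      ENNReal.toReal_ofReal (abs_nonneg _), abs_of_pos (by positivity), measureReal_def]
  have hanti : Antitone fun s : ℝ => μ {y | s ≤ (H y 1)⁻¹} := fun s t hst =>
    measure_mono fun y hy => hst.trans hy
  have hint := integrable_inv_pow_of_le μ hc hc0 h (p := finrank ℝ V + (q + 1)) (by omega)
  -- Layer cake for 1 / H(·, 1) to the power d + q + 1: the weight s^(d+q) is s^q times the dilation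
  -- factor.
  have key := lintegral_pow_eq_lintegral_meas_le μ (fun y => (inv_pos.2 (hpos y)).le)
    (hc.inv₀ fun y => (hpos y).ne').measurable (finrank ℝ V + q)
  simp only [inv_pow] at key
  have e₁ : ∫ y, (H y 1 ^ (finrank ℝ V + (q + 1)))⁻¹ ∂μ =
      (∫⁻ y, ENNReal.ofReal (H y 1 ^ (finrank ℝ V + q + 1))⁻¹ ∂μ).toReal :=
    integral_eq_lintegral_of_nonneg_ae
      (Filter.Eventually.of_forall fun y => (inv_pos.2 (pow_pos (hpos y) _)).le)
      hint.aestronglyMeasurable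
  have e₂ : ∫ s in Set.Ioi (0 : ℝ), s ^ q * μ.real {y | H y s ≤ 1} =
      ∫ s in Set.Ioi (0 : ℝ), s ^ (finrank ℝ V + q) * (μ {y | s ≤ (H y 1)⁻¹}).toReal := by
    refine setIntegral_congr_fun measurableSet_Ioi fun s hs => ?_
    rw [hslice s hs, pow_add, measureReal_def]
    ring
  have e₃ : ∫ s in Set.Ioi (0 : ℝ), s ^ (finrank ℝ V + q) * (μ {y | s ≤ (H y 1)⁻¹}).toReal =
      (∫⁻ s in Set.Ioi (0 : ℝ), μ {y | s ≤ (H y 1)⁻¹} *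
        ENNReal.ofReal (s ^ (finrank ℝ V + q))).toReal := by
    rw [integral_eq_lintegral_of_nonneg_ae]
    · congr 1
      refine setLIntegral_congr_fun measurableSet_Ioi fun s hs => ?_
      have hs : 0 < s := hs
      rw [ENNReal.ofReal_mul (by positivity), ENNReal.ofReal_toReal (hfin s hs), mul_comm]
    · filter_upwards [self_mem_ae_restrict measurableSet_Ioi] with s hs
      have hs : 0 < s := hs
      positivity
    · exact ((measurable_id.pow_const _).mul
        hanti.measurable.ennreal_toReal).aestronglyMeasurable
  rw [e₂, e₃, e₁, key, ENNReal.toReal_mul, ENNReal.toReal_ofReal (by positivity), ← mul_assoc]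
  push_cast
  rw [inv_mul_cancel₀ (by positivity), one_mul]

/-! ### Orthogonal splitting and the fibrewise seminorm estimate -/

/-- Adding an orthogonal unit vector to a subspace. -/
theorem exists_measurableEquiv_add_smul {n : ℕ} {F G : Submodule ℝ (EuclideanSpace ℝ (Fin n))}
    {v : EuclideanSpace ℝ (Fin n)} (hv : ‖v‖ = 1) (hF : ∀ y ∈ F, ⟪y, v⟫ = 0)
    (hG : F ⊔ Submodule.span ℝ {v} = G) :
    ∃ e : (F × ℝ) ≃ᵐ G, MeasurePreserving e ((lebesgueOn F).prod volume) (lebesgueOn G) ∧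
      ∀ y s, (e (y, s) : EuclideanSpace ℝ (Fin n)) = y + s • v := by
  have hmem : ∀ (y : F) (s : ℝ), (y : EuclideanSpace ℝ (Fin n)) + s • v ∈ G := fun y s =>
    hG ▸ Submodule.add_mem_sup y.2 (Submodule.smul_mem _ _ (Submodule.mem_span_singleton_self v))
  -- With the L² norm on the product, (y, s) ↦ y + s v is an isometry by Pythagoras, hence preserves
  -- Lebesgue measure.
  let f : WithLp 2 (F × ℝ) →ₗ[ℝ] G :=
    { toFun := fun p => ⟨p.fst + p.snd • v, hmem _ _⟩
      map_add' := fun p q => Subtype.ext (by simp [add_smul]; abel)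
      map_smul' := fun c p => Subtype.ext (by simp [mul_smul]) }
  let li : WithLp 2 (F × ℝ) →ₗᵢ[ℝ] G :=
    { f with
      norm_map' := fun p => by
        have h₁ : ‖((p.fst : EuclideanSpace ℝ (Fin n)) + p.snd • v)‖ ^ 2 = ‖p‖ ^ 2 := by
          rw [norm_add_sq_real, inner_smul_right, hF _ p.fst.2, norm_smul, hv,
            WithLp.prod_norm_sq_eq_of_L2]
          simp
        exact (sq_eq_sq₀ (norm_nonneg _) (norm_nonneg _)).1 h₁ }
  have hs : Function.Surjective li := by
    rintro ⟨z, hz⟩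
    rw [← hG] at hz
    obtain ⟨y, hy, w, hw, rfl⟩ := Submodule.mem_sup.1 hz
    obtain ⟨s, rfl⟩ := Submodule.mem_span_singleton.1 hw
    exact ⟨WithLp.toLp 2 (⟨y, hy⟩, s), rfl⟩
  let e := LinearIsometryEquiv.ofSurjective li hs
  refine ⟨(MeasurableEquiv.toLp 2 (F × ℝ)).trans e.toHomeomorph.toMeasurableEquiv,
    e.measurePreserving.comp (WithLp.volume_preserving_toLp F ℝ), fun y s => rfl⟩

section Gauge

variable {X F : Type*} [NormedAddCommGroup X] [NormedSpace ℝ X] [NormedAddCommGroup F]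
  [NormedSpace ℝ F] [MeasurableSpace F] [BorelSpace F]

/-- The volume of the image of a convex compact set under `(A, ℓ)` is a seminorm in the linear
functional `ℓ`. -/
theorem measureReal_image_prodMk_add_smul_le (μ : Measure F) [IsFiniteMeasureOnCompacts μ]
    [SFinite μ] (A : X →L[ℝ] F) {K : Set X} (hK : IsCompact K) (hc : Convex ℝ K)
    (ℓ₁ ℓ₂ : X →L[ℝ] ℝ) (a b : ℝ) :
    (μ.prod volume).real ((fun z => (A z, (a • ℓ₁ + b • ℓ₂) z)) '' K) ≤
      |a| * (μ.prod volume).real ((fun z => (A z, ℓ₁ z)) '' K) +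
      |b| * (μ.prod volume).real ((fun z => (A z, ℓ₂ z)) '' K) := by
  have hcpt : ∀ ℓ : X →L[ℝ] ℝ, IsCompact ((fun z => (A z, ℓ z)) '' K) := fun ℓ =>
    hK.image (by fun_prop)
  have hslice : ∀ (ℓ : X →L[ℝ] ℝ) (e : F), volume (Prod.mk e ⁻¹' ((fun z => (A z, ℓ z)) '' K)) =
      Metric.ediam (ℓ '' (K ∩ A ⁻¹' {e})) := fun ℓ e => by
    have : Prod.mk e ⁻¹' ((fun z => (A z, ℓ z)) '' K) = ℓ '' (K ∩ A ⁻¹' {e}) := by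
      ext r
      simp only [Set.mem_preimage, Set.mem_image, Prod.mk.injEq, Set.mem_inter_iff,
        Set.mem_singleton_iff, and_assoc]
    rw [this]
    refine volume_eq_ediam_of_convex ?_ ?_
    · exact (hc.inter ((convex_singleton e).linear_preimage A.toLinearMap)).linear_image
        ℓ.toLinearMap
    · exact (hK.inter_right (isClosed_singleton.preimage A.continuous)).image ℓ.continuous
  have hvol : ∀ ℓ : X →L[ℝ] ℝ, (μ.prod volume) ((fun z => (A z, ℓ z)) '' K) =
      ∫⁻ e, Metric.ediam (ℓ '' (K ∩ A ⁻¹' {e})) ∂μ := fun ℓ => by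
    rw [Measure.prod_apply (hcpt ℓ).measurableSet]
    exact lintegral_congr (hslice ℓ)
  have hmeas : Measurable fun e => Metric.ediam (ℓ₁ '' (K ∩ A ⁻¹' {e})) := by
    simp only [← hslice]
    exact measurable_measure_prodMk_left (hcpt ℓ₁).measurableSet
  have hfin : ∀ ℓ : X →L[ℝ] ℝ, (μ.prod volume) ((fun z => (A z, ℓ z)) '' K) ≠ ⊤ := fun ℓ =>
    (hcpt ℓ).measure_ne_top
  have hle : (μ.prod volume) ((fun z => (A z, (a • ℓ₁ + b • ℓ₂) z)) '' K) ≤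
      ENNReal.ofReal |a| * (μ.prod volume) ((fun z => (A z, ℓ₁ z)) '' K) +
      ENNReal.ofReal |b| * (μ.prod volume) ((fun z => (A z, ℓ₂ z)) '' K) := by
    rw [hvol, hvol, hvol, ← lintegral_const_mul' _ _ ENNReal.ofReal_ne_top,
      ← lintegral_const_mul' _ _ ENNReal.ofReal_ne_top,
      ← lintegral_add_left (hmeas.const_mul _)]
    refine lintegral_mono fun e => ?_
    -- On a fibre, the oscillation of a ℓ₁ + b ℓ₂ between two points is at most |a| times that of ℓ₁
    -- plus |b| times that of ℓ₂. The diameter also covers empty fibres.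
    refine Metric.ediam_le ?_
    rintro _ ⟨z, hz, rfl⟩ _ ⟨w, hw, rfl⟩
    have h₁ := Metric.edist_le_ediam_of_mem (Set.mem_image_of_mem ℓ₁ hz)
      (Set.mem_image_of_mem ℓ₁ hw)
    have h₂ := Metric.edist_le_ediam_of_mem (Set.mem_image_of_mem ℓ₂ hz)
      (Set.mem_image_of_mem ℓ₂ hw)
    refine le_trans ?_ (add_le_add (mul_le_mul_right h₁ _) (mul_le_mul_right h₂ _))
    rw [edist_dist, edist_dist, edist_dist, ← ENNReal.ofReal_mul (abs_nonneg _),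
      ← ENNReal.ofReal_mul (abs_nonneg _), ← ENNReal.ofReal_add (by positivity) (by positivity)]
    refine ENNReal.ofReal_le_ofReal ?_
    rw [Real.dist_eq, Real.dist_eq, Real.dist_eq, ← abs_mul, ← abs_mul]
    refine le_trans (le_of_eq ?_) (abs_add_le _ _)
    congr 1
    simp
    ring
  rw [measureReal_def, measureReal_def, measureReal_def]
  calc _ ≤ (ENNReal.ofReal |a| * (μ.prod volume) ((fun z => (A z, ℓ₁ z)) '' K) +
      ENNReal.ofReal |b| * (μ.prod volume) ((fun z => (A z, ℓ₂ z)) '' K)).toReal :=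
        ENNReal.toReal_mono (ENNReal.add_ne_top.2
          ⟨ENNReal.mul_ne_top ENNReal.ofReal_ne_top (hfin _),
            ENNReal.mul_ne_top ENNReal.ofReal_ne_top (hfin _)⟩) hle
    _ = _ := by
      rw [ENNReal.toReal_add (ENNReal.mul_ne_top ENNReal.ofReal_ne_top (hfin _))
        (ENNReal.mul_ne_top ENNReal.ofReal_ne_top (hfin _)), ENNReal.toReal_mul,
        ENNReal.toReal_mul, ENNReal.toReal_ofReal (abs_nonneg _),
        ENNReal.toReal_ofReal (abs_nonneg _)]

end Gauge

instance lebesgueOn.isAddHaarMeasure {n : ℕ} (F : Submodule ℝ (EuclideanSpace ℝ (Fin n))) :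
    (lebesgueOn F).IsAddHaarMeasure :=
  inferInstanceAs (Measure.IsAddHaarMeasure (@volume F measureSpaceOfInnerProductSpace))

/-! ### The function x ↦ |P_{E ∧ x} K| on E^⊥ -/

section ShadowSystems

variable {n : ℕ} {E : Submodule ℝ (EuclideanSpace ℝ (Fin n))} {u : EuclideanSpace ℝ (Fin n)}
  {K : Set (EuclideanSpace ℝ (Fin n))}

theorem prod_preimage_mul_right {F : Type*} [MeasurableSpace F] (μ : Measure F) [SFinite μ]
    {c : ℝ} (hc : 0 < c) {S : Set (F × ℝ)} (hS : MeasurableSet S) :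
    c * (μ.prod volume).real ((fun p : F × ℝ => (p.1, c * p.2)) ⁻¹' S) =
      (μ.prod volume).real S := by
  have h := Measure.map_prod_map μ (volume : Measure ℝ) measurable_id (measurable_const_mul c)
  rw [Measure.map_id, Real.map_volume_mul_left hc.ne', Measure.prod_smul_right] at h
  have hm : Measurable fun p : F × ℝ => (p.1, c * p.2) := by fun_prop
  have h' : (μ.prod volume) ((fun p : F × ℝ => (p.1, c * p.2)) ⁻¹' S) =
      ENNReal.ofReal |c⁻¹| * (μ.prod volume) S := by
    rw [← Measure.map_apply hm hS, ← smul_eq_mul, ← Measure.smul_apply, h]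
    rfl
  rw [measureReal_def, h', ENNReal.toReal_mul, ENNReal.toReal_ofReal (abs_nonneg _),
    abs_of_pos (inv_pos.2 hc), ← mul_assoc, mul_inv_cancel₀ hc.ne', one_mul, measureReal_def]

theorem starProjection_sup_span_singleton {F G : Submodule ℝ (EuclideanSpace ℝ (Fin n))}
    {v : EuclideanSpace ℝ (Fin n)} (hv : ‖v‖ = 1) (hF : ∀ y ∈ F, ⟪y, v⟫ = 0)
    (hG : F ⊔ Submodule.span ℝ {v} = G) (z : EuclideanSpace ℝ (Fin n)) :
    G.starProjection z = F.starProjection z + ⟪z, v⟫ • v := by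
  subst hG
  refine Submodule.eq_starProjection_of_mem_of_inner_eq_zero (Submodule.add_mem_sup
    (Submodule.starProjection_apply_mem F z)
    (Submodule.smul_mem _ _ (Submodule.mem_span_singleton_self v))) fun w hw => ?_
  obtain ⟨y, hy, w', hw', hyw⟩ := Submodule.mem_sup.1 hw
  obtain ⟨s, hs⟩ := Submodule.mem_span_singleton.1 hw'
  rw [← hyw, ← hs]
  have h₁ : ⟪z - F.starProjection z, y⟫ = 0 := Submodule.starProjection_inner_eq_zero z y hy
  have h₂ : ⟪v, y⟫ = 0 := by rw [real_inner_comm, hF y hy]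
  have h₃ := hF _ (Submodule.starProjection_apply_mem F z)
  rw [← sub_sub, inner_add_right, inner_sub_left, h₁, real_inner_smul_left, h₂,
    inner_smul_right, inner_sub_left, inner_sub_left, h₃, real_inner_smul_left,
    real_inner_self_eq_norm_sq, hv]
  ring

/-- `|P_{E ∧ x} K|` is the volume of `{(P_E z, ⟨z, x⟩) ; z ∈ K}`. -/
theorem wedgeVol_eq_measureReal_image {x : EuclideanSpace ℝ (Fin n)} (hx : x ∈ Eᗮ)
    {K : Set (EuclideanSpace ℝ (Fin n))} (hK : IsCompact K) :
    wedgeVol E x K = ((lebesgueOn E).prod volume).real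
      ((fun z => (E.orthogonalProjectionOnto z, innerSL ℝ x z)) '' K) := by
  have hPx : ‖Eᗮ.orthogonalProjectionOnto x‖ = ‖x‖ := by
    rw [Submodule.orthogonalProjectionOnto_mem_subspace_eq_self (⟨x, hx⟩ : Eᗮ)]
    rfl
  rw [wedgeVol, hPx]
  -- For x = 0 the image lies in the null set E × {0}. Otherwise span(E, x) splits along v = x /
  -- ‖x‖, and stretching the last coordinate by ‖x‖ yields the factor |P_{E^⊥} x|.
  rcases eq_or_ne x 0 with rfl | hx0
  · have : ((lebesgueOn E).prod volume) (Set.univ ×ˢ ({0} : Set ℝ)) = 0 := by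
      rw [Measure.prod_prod, Real.volume_singleton, mul_zero]
    rw [norm_zero, zero_mul, measureReal_def, measure_mono_null _ this, ENNReal.toReal_zero]
    rintro _ ⟨z, -, rfl⟩
    simp
  have hn : 0 < ‖x‖ := norm_pos_iff.2 hx0
  set v := ‖x‖⁻¹ • x with hv
  have hv1 : ‖v‖ = 1 := by rw [hv, norm_smul, norm_inv, norm_norm, inv_mul_cancel₀ hn.ne']
  have hxE : ∀ y ∈ E, ⟪y, x⟫ = 0 := fun y hy => Submodule.inner_right_of_mem_orthogonal hy hx
  have hvE : ∀ y ∈ E, ⟪y, v⟫ = 0 := fun y hy => by rw [hv, inner_smul_right, hxE y hy, mul_zero]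
  have hspan : E ⊔ Submodule.span ℝ {v} = E ⊔ Submodule.span ℝ {x} := by
    rw [hv, Submodule.span_singleton_smul_eq (isUnit_iff_ne_zero.2 (inv_ne_zero hn.ne'))]
  obtain ⟨e, he, hev⟩ := exists_measurableEquiv_add_smul hv1 hvE hspan
  have hproj : ∀ z, (E ⊔ Submodule.span ℝ {x}).orthogonalProjectionOnto z =
      e (E.orthogonalProjectionOnto z, ⟪z, v⟫) := fun z => by
    refine Subtype.ext ?_
    rw [hev]
    exact starProjection_sup_span_singleton hv1 hvE hspan z
  have hS : MeasurableSet ((fun z => (E.orthogonalProjectionOnto z, innerSL ℝ x z)) '' K) :=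
    (hK.image (by fun_prop)).measurableSet
  have hset : e ⁻¹' ((E ⊔ Submodule.span ℝ {x}).orthogonalProjectionOnto '' K) =
      (fun p : E × ℝ => (p.1, ‖x‖ * p.2)) ⁻¹'
        ((fun z => (E.orthogonalProjectionOnto z, innerSL ℝ x z)) '' K) := by
    ext ⟨y, s⟩
    simp only [Set.mem_preimage, Set.mem_image, hproj, e.injective.eq_iff, Prod.mk.injEq, hv,
      inner_smul_right, innerSL_apply_apply]
    refine exists_congr fun z => and_congr_right fun _ => and_congr_right fun _ => ?_
    rw [real_inner_comm, inv_mul_eq_iff_eq_mul₀ hn.ne']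
  rw [← prod_preimage_mul_right _ hn hS, ← hset, projVol, measureReal_def, measureReal_def,
    he.measure_preimage_equiv]

theorem wedgeVol_nonneg (x : EuclideanSpace ℝ (Fin n)) : 0 ≤ wedgeVol E x K :=
  mul_nonneg (norm_nonneg _) measureReal_nonneg

/-- `|P_{E ∧ x} K|` is a seminorm in `x ∈ E^⊥`. -/
theorem wedgeVol_add_smul_le (hK : IsCompact K) (hc : Convex ℝ K) {x y : EuclideanSpace ℝ (Fin n)}
    (hx : x ∈ Eᗮ) (hy : y ∈ Eᗮ) (a b : ℝ) :
    wedgeVol E (a • x + b • y) K ≤ |a| * wedgeVol E x K + |b| * wedgeVol E y K := by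
  rw [wedgeVol_eq_measureReal_image hx hK, wedgeVol_eq_measureReal_image hy hK,
    wedgeVol_eq_measureReal_image (Eᗮ.add_mem (Eᗮ.smul_mem a hx) (Eᗮ.smul_mem b hy)) hK]
  have : innerSL ℝ (a • x + b • y) = a • innerSL ℝ x + b • innerSL ℝ y := by simp
  rw [this]
  exact measureReal_image_prodMk_add_smul_le _ _ hK hc _ _ a b

/-- The seminorm bound gives one inequality; applied to a • x with the scalar a⁻¹, it gives the
other. -/
theorem wedgeVol_smul (hK : IsCompact K) (hc : Convex ℝ K) {x : EuclideanSpace ℝ (Fin n)}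
    (hx : x ∈ Eᗮ) {a : ℝ} (ha : a ≠ 0) : wedgeVol E (a • x) K = |a| * wedgeVol E x K := by
  refine le_antisymm ?_ ?_
  · simpa using wedgeVol_add_smul_le hK hc hx hx a 0
  · have := wedgeVol_add_smul_le hK hc (Eᗮ.smul_mem a hx) hx a⁻¹ 0
    rw [zero_smul, add_zero, inv_smul_smul₀ ha, abs_zero, zero_mul, add_zero, abs_inv] at this
    rwa [inv_mul_eq_div, le_div_iff₀' (abs_pos.2 ha)] at this

theorem continuous_wedgeVol (hK : IsCompact K) (hc : Convex ℝ K) :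
    Continuous fun x : Eᗮ => wedgeVol E (x : EuclideanSpace ℝ (Fin n)) K := by
  have : ConvexOn ℝ Set.univ fun x : Eᗮ => wedgeVol E (x : EuclideanSpace ℝ (Fin n)) K := by
    refine ⟨convex_univ, fun x _ y _ a b ha hb _ => ?_⟩
    have := wedgeVol_add_smul_le hK hc x.2 y.2 a b
    rwa [abs_of_nonneg ha, abs_of_nonneg hb] at this
  exact continuousOn_univ.1 (this.continuousOn isOpen_univ)

/-- A ball of radius ε around z₀ inside K makes the image contain the product of a ball of radius ε
/ 2 in E and an interval of length ε ‖x‖. -/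
theorem exists_mul_norm_le_wedgeVol (hK : IsConvexBody K) :
    ∃ c > 0, ∀ x ∈ Eᗮ, c * ‖x‖ ≤ wedgeVol E x K := by
  obtain ⟨z₀, hz₀⟩ := hK.nonempty_interior
  obtain ⟨ε, hε, hball⟩ := Metric.isOpen_iff.1 isOpen_interior z₀ hz₀
  set B := Metric.ball (E.orthogonalProjectionOnto z₀) (ε / 2) with hB
  have hBpos : 0 < (lebesgueOn E).real B :=
    ENNReal.toReal_pos (Metric.measure_ball_pos _ _ (by positivity)).ne' measure_ball_lt_top.ne
  refine ⟨(lebesgueOn E).real B * ε, by positivity, fun x hx => ?_⟩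
  rcases eq_or_ne x 0 with rfl | hx0
  · rw [norm_zero, mul_zero]
    exact wedgeVol_nonneg _
  have hn : 0 < ‖x‖ := norm_pos_iff.2 hx0
  rw [wedgeVol_eq_measureReal_image hx hK.isCompact]
  have hsub : B ×ˢ Metric.ball (innerSL ℝ x z₀) (ε / 2 * ‖x‖) ⊆
      (fun z => (E.orthogonalProjectionOnto z, innerSL ℝ x z)) '' K := by
    rintro ⟨e, r⟩ ⟨he, hr⟩
    have he : ‖e - E.orthogonalProjectionOnto z₀‖ < ε / 2 := mem_ball_iff_norm.1 he
    have hr : |r - ⟪x, z₀⟫| < ε / 2 * ‖x‖ := mem_ball_iff_norm.1 hr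
    have h₀ : E.orthogonalProjectionOnto x = 0 :=
      Submodule.orthogonalProjectionOnto_eq_zero_iff.2 hx
    have h₁ : ⟪x, ((e - E.orthogonalProjectionOnto z₀ : E) : EuclideanSpace ℝ (Fin n))⟫ = 0 :=
      Submodule.inner_left_of_mem_orthogonal (Subtype.mem _) hx
    -- The preimage of (e, r): a displacement in E corrects the projection, and a multiple of x ⊥ E
    -- corrects the inner product; each has norm below ε / 2.
    refine ⟨z₀ + ((e - E.orthogonalProjectionOnto z₀ : E) +
      ((r - ⟪x, z₀⟫) / ‖x‖ ^ 2) • x), interior_subset (hball ?_), ?_⟩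
    · rw [mem_ball_iff_norm, add_sub_cancel_left]
      refine (norm_add_le _ _).trans_lt ?_
      have : ‖((r - ⟪x, z₀⟫) / ‖x‖ ^ 2) • x‖ < ε / 2 := by
        rw [norm_smul, Real.norm_eq_abs, abs_div, abs_of_pos (pow_pos hn 2),
          div_mul_eq_mul_div, div_lt_iff₀ (pow_pos hn 2)]
        nlinarith
      rw [← Submodule.coe_norm] at *
      linarith
    · refine Prod.ext ?_ ?_
      · simp only [map_add, map_smul, h₀, smul_zero, add_zero,
          Submodule.orthogonalProjectionOnto_mem_subspace_eq_self, add_sub_cancel]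
      · simp only [innerSL_apply_apply, inner_add_right, h₁, inner_smul_right,
          real_inner_self_eq_norm_sq]
        field_simp
        ring
  calc (lebesgueOn E).real B * ε * ‖x‖
      = ((lebesgueOn E).prod volume).real
        (B ×ˢ Metric.ball (innerSL ℝ x z₀) (ε / 2 * ‖x‖)) := by
        rw [measureReal_prod_prod, measureReal_def volume, Real.volume_ball,
          ENNReal.toReal_ofReal (by positivity)]
        ring
    _ ≤ _ := measureReal_mono hsub (hK.isCompact.image (by fun_prop)).measure_ne_top

theorem isCompact_projPolar (hK : IsConvexBody K) : IsCompact (projPolar E K) := by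
  obtain ⟨c, hc, h⟩ := exists_mul_norm_le_wedgeVol (E := E) hK
  refine Metric.isCompact_of_isClosed_isBounded
    (isClosed_le (continuous_wedgeVol hK.isCompact hK.convex) continuous_const)
    ((Metric.isBounded_closedBall (x := (0 : Eᗮ)) (r := 1 / c)).subset fun x hx => ?_)
  rw [mem_closedBall_zero_iff, le_div_iff₀' hc]
  exact (h x x.2).trans hx

/-! ### Moments of L_E(K) as integrals over sections -/

theorem mem_orthogonal_of_le_orthogonal_span (hEu : E ≤ (Submodule.span ℝ {u})ᗮ) : u ∈ Eᗮ :=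
  fun _ hy => Submodule.mem_orthogonal_singleton_iff_inner_left.1 (hEu hy)

theorem inf_sup_span_singleton (hu : ‖u‖ = 1) (hEu : E ≤ (Submodule.span ℝ {u})ᗮ) :
    (Eᗮ ⊓ (Submodule.span ℝ {u})ᗮ) ⊔ Submodule.span ℝ {u} = Eᗮ := by
  have huE := mem_orthogonal_of_le_orthogonal_span hEu
  refine le_antisymm (sup_le inf_le_left ?_) fun x hx => ?_
  · rw [Submodule.span_singleton_le_iff_mem]
    exact huE
  · rw [← sub_add_cancel x (⟪x, u⟫ • u)]
    refine Submodule.add_mem_sup ⟨Eᗮ.sub_mem hx (Eᗮ.smul_mem _ huE), ?_⟩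
      (Submodule.smul_mem _ _ (Submodule.mem_span_singleton_self u))
    rw [SetLike.mem_coe, Submodule.mem_orthogonal_singleton_iff_inner_left, inner_sub_left,
      real_inner_smul_left, real_inner_self_eq_norm_sq, hu]
    ring

theorem inner_eq_zero_of_mem_inf {y : EuclideanSpace ℝ (Fin n)}
    (hy : y ∈ Eᗮ ⊓ (Submodule.span ℝ {u})ᗮ) : ⟪y, u⟫ = 0 :=
  Submodule.mem_orthogonal_singleton_iff_inner_left.1 hy.2

/-- Fubini's theorem on `E^⊥` along the direction `u`. -/
theorem setIntegral_projPolar_comp_inner (hu : ‖u‖ = 1) (hEu : E ≤ (Submodule.span ℝ {u})ᗮ)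
    (hK : IsConvexBody K) {f : ℝ → ℝ}
    (hf : IntegrableOn (fun x : Eᗮ => f ⟪(x : EuclideanSpace ℝ (Fin n)), u⟫) (projPolar E K)
      (lebesgueOn Eᗮ)) :
    ∫ x in projPolar E K, f ⟪(x : EuclideanSpace ℝ (Fin n)), u⟫ ∂(lebesgueOn Eᗮ) =
      ∫ s, f s * sectionVol E u s K := by
  obtain ⟨e, he, hev⟩ := exists_measurableEquiv_add_smul hu
    (fun y hy => inner_eq_zero_of_mem_inf hy) (inf_sup_span_singleton hu hEu)
  have hinner : ∀ y s, ⟪(e (y, s) : EuclideanSpace ℝ (Fin n)), u⟫ = s := fun y s => by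
    rw [hev, inner_add_left, inner_eq_zero_of_mem_inf y.2, real_inner_smul_left,
      real_inner_self_eq_norm_sq, hu]
    ring
  have hL := (isCompact_projPolar (E := E) hK).measurableSet
  have hsec : ∀ s, projPolarSection E u s K = (fun y => (y, s)) ⁻¹' (e ⁻¹' projPolar E K) :=
    fun s => by
      ext y
      simp only [projPolarSection, projPolar, Set.mem_preimage, Set.mem_ofPred_eq, hev]
  have hLs : ∀ s, MeasurableSet (projPolarSection E u s K) := fun s => by
    rw [hsec]
    exact measurable_prodMk_right (e.measurable hL)
  rw [← integrable_indicator_iff hL,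
    ← he.integrable_comp_emb e.measurableEmbedding] at hf
  rw [← integral_indicator hL, ← he.integral_comp e.measurableEmbedding]
  refine (integral_prod_symm _ hf).trans (integral_congr_ae
    (Filter.Eventually.of_forall fun s => ?_))
  have : (fun y => (projPolar E K).indicator
      (fun x : Eᗮ => f ⟪(x : EuclideanSpace ℝ (Fin n)), u⟫) (e (y, s))) =
      (projPolarSection E u s K).indicator fun _ => f s := by
    funext y
    rw [hsec]
    by_cases h : e (y, s) ∈ projPolar E K
    · rw [Set.indicator_of_mem h, hinner]
      exact (Set.indicator_of_mem (s := (fun y => (y, s)) ⁻¹' (e ⁻¹' projPolar E K)) h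
        fun _ => f s).symm
    · rw [Set.indicator_of_notMem h]
      exact (Set.indicator_of_notMem (s := (fun y => (y, s)) ⁻¹' (e ⁻¹' projPolar E K)) h
        fun _ => f s).symm
  simp only [Function.comp_apply]
  rw [this, integral_indicator_const _ (hLs s), smul_eq_mul, mul_comm, sectionVol]

theorem integrableOn_projPolar_abs_inner_pow (hK : IsConvexBody K) (q : ℕ) :
    IntegrableOn (fun x : Eᗮ => |⟪(x : EuclideanSpace ℝ (Fin n)), u⟫| ^ q) (projPolar E K)
      (lebesgueOn Eᗮ) :=
  ContinuousOn.integrableOn_compact (isCompact_projPolar hK) (by fun_prop)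

theorem integrableOn_projPolar_inner_pow (hK : IsConvexBody K) (q : ℕ) :
    IntegrableOn (fun x : Eᗮ => ⟪(x : EuclideanSpace ℝ (Fin n)), u⟫ ^ q) (projPolar E K)
      (lebesgueOn Eᗮ) :=
  ContinuousOn.integrableOn_compact (isCompact_projPolar hK) (by fun_prop)

theorem moment_projPolar (hu : ‖u‖ = 1) (hEu : E ≤ (Submodule.span ℝ {u})ᗮ)
    (hK : IsConvexBody K) (k : ℕ) :
    moment k u E (projPolar E K) = ∫ s : ℝ, |s| ^ (k - 1) * sectionVol E u s K :=
  setIntegral_projPolar_comp_inner hu hEu hK (f := fun s => |s| ^ (k - 1))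
    (integrableOn_projPolar_abs_inner_pow hK _)

theorem momentPos_projPolar (hu : ‖u‖ = 1) (hEu : E ≤ (Submodule.span ℝ {u})ᗮ)
    (hK : IsConvexBody K) (k : ℕ) :
    momentPos k u E (projPolar E K) =
      ∫ s in Set.Ioi (0 : ℝ), s ^ (k - 1) * sectionVol E u s K := by
  have hP : MeasurableSet {x : Eᗮ | 0 < ⟪(x : EuclideanSpace ℝ (Fin n)), u⟫} :=
    (isOpen_lt continuous_const (by fun_prop)).measurableSet
  -- The half-space is moved into the integrand as an indicator, so that Fubini over the whole body
  -- applies, also when k = 1.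
  have hind : (fun x : Eᗮ => (Set.Ioi (0 : ℝ)).indicator (fun s => s ^ (k - 1))
      ⟪(x : EuclideanSpace ℝ (Fin n)), u⟫) =
      {x : Eᗮ | 0 < ⟪(x : EuclideanSpace ℝ (Fin n)), u⟫}.indicator
        fun x => ⟪(x : EuclideanSpace ℝ (Fin n)), u⟫ ^ (k - 1) := rfl
  have := setIntegral_projPolar_comp_inner hu hEu hK
    (f := (Set.Ioi (0 : ℝ)).indicator fun s => s ^ (k - 1))
    (by rw [hind]; exact (integrableOn_projPolar_inner_pow hK _).indicator hP)
  rw [hind, setIntegral_indicator hP] at this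
  refine this.trans ?_
  rw [← integral_indicator measurableSet_Ioi]
  refine integral_congr_ae (Filter.Eventually.of_forall fun s => ?_)
  simp only [Set.indicator, ite_mul, zero_mul]

theorem sectionVol_neg (hEu : E ≤ (Submodule.span ℝ {u})ᗮ) (hK : IsCompact K) (hc : Convex ℝ K)
    (s : ℝ) : sectionVol E u (-s) K = sectionVol E u s K := by
  have huE := mem_orthogonal_of_le_orthogonal_span hEu
  have : projPolarSection E u (-s) K = Neg.neg ⁻¹' projPolarSection E u s K := by
    ext y
    have h := wedgeVol_smul hK hc (Eᗮ.add_mem y.2.1 (Eᗮ.smul_mem (-s) huE))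
      (neg_ne_zero.2 (one_ne_zero (α := ℝ)))
    have e : (-1 : ℝ) • ((y : EuclideanSpace ℝ (Fin n)) + (-s) • u) =
      ((-y : (Eᗮ ⊓ (Submodule.span ℝ {u})ᗮ : Submodule ℝ _)) : EuclideanSpace ℝ (Fin n)) + s • u := by
      simp
    rw [e, abs_neg, abs_one, one_mul] at h
    simp only [projPolarSection, Set.mem_preimage, Set.mem_ofPred_eq, h]
  rw [sectionVol, this, measureReal_def, Measure.measure_preimage_neg]
  rfl

/-- The sections at heights s and -s have equal volume by central symmetry, so the two-sided
statements reduce to the one-sided ones. -/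
theorem moment_eq_two_mul_momentPos (hu : ‖u‖ = 1) (hEu : E ≤ (Submodule.span ℝ {u})ᗮ)
    (hK : IsConvexBody K) (k : ℕ) :
    moment k u E (projPolar E K) = 2 * momentPos k u E (projPolar E K) := by
  rw [moment_projPolar hu hEu hK, momentPos_projPolar hu hEu hK,
    ← integral_comp_abs (f := fun s => s ^ (k - 1) * sectionVol E u s K)]
  refine integral_congr_ae (Filter.Eventually.of_forall fun s => ?_)
  dsimp only
  congr 1
  rcases abs_choice s with h | h <;> rw [h]
  rw [sectionVol_neg hEu hK.isCompact hK.convex]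

theorem exists_mul_one_add_norm_le_wedgeVol (hu : ‖u‖ = 1) (hEu : E ≤ (Submodule.span ℝ {u})ᗮ)
    (hK : IsConvexBody K) :
    ∃ c > 0, ∀ y : (Eᗮ ⊓ (Submodule.span ℝ {u})ᗮ : Submodule ℝ (EuclideanSpace ℝ (Fin n))),
      c * (1 + ‖y‖) ≤ wedgeVol E ((y : EuclideanSpace ℝ (Fin n)) + u) K := by
  obtain ⟨c, hc, h⟩ := exists_mul_norm_le_wedgeVol (E := E) hK
  refine ⟨c / 2, by positivity, fun y => le_trans ?_ (h _ (Eᗮ.add_mem y.2.1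
    (mem_orthogonal_of_le_orthogonal_span hEu)))⟩
  have : ‖(y : EuclideanSpace ℝ (Fin n)) + u‖ ^ 2 = ‖y‖ ^ 2 + 1 := by
    rw [norm_add_sq_real, inner_eq_zero_of_mem_inf y.2, hu]
    simp
  have h₂ : 1 + ‖y‖ ≤ 2 * ‖(y : EuclideanSpace ℝ (Fin n)) + u‖ := by
    refine le_of_sq_le_sq ?_ (by positivity)
    nlinarith [sq_nonneg (‖y‖ - 1)]
  nlinarith

theorem momentPos_projPolar_eq_integral_inv_pow (hu : ‖u‖ = 1)
    (hEu : E ≤ (Submodule.span ℝ {u})ᗮ) (hK : IsConvexBody K) {k : ℕ} (hk : 1 ≤ k) :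
    momentPos k u E (projPolar E K) =
      (↑(finrank ℝ (Eᗮ ⊓ (Submodule.span ℝ {u})ᗮ : Submodule ℝ (EuclideanSpace ℝ (Fin n))) + k))⁻¹
        * ∫ y, (wedgeVol E ((y : EuclideanSpace ℝ (Fin n)) + u) K ^
          (finrank ℝ (Eᗮ ⊓ (Submodule.span ℝ {u})ᗮ : Submodule ℝ (EuclideanSpace ℝ (Fin n))) + k))⁻¹
          ∂(lebesgueOn (Eᗮ ⊓ (Submodule.span ℝ {u})ᗮ)) := by
  obtain ⟨q, rfl⟩ := Nat.exists_eq_add_of_le' hk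
  have huE := mem_orthogonal_of_le_orthogonal_span hEu
  obtain ⟨c, hc, h⟩ := exists_mul_one_add_norm_le_wedgeVol hu hEu hK
  have hcont : Continuous fun y : (Eᗮ ⊓ (Submodule.span ℝ {u})ᗮ : Submodule ℝ _) =>
      wedgeVol E ((y : EuclideanSpace ℝ (Fin n)) + (1 : ℝ) • u) K :=
    (continuous_wedgeVol hK.isCompact hK.convex).comp
      (f := fun y : (Eᗮ ⊓ (Submodule.span ℝ {u})ᗮ : Submodule ℝ _) =>
        (⟨y + (1 : ℝ) • u, Eᗮ.add_mem y.2.1 (Eᗮ.smul_mem _ huE)⟩ : Eᗮ)) (by fun_prop)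
  have := integral_pow_mul_measure_slice (lebesgueOn (Eᗮ ⊓ (Submodule.span ℝ {u})ᗮ))
    (H := fun y s => wedgeVol E ((y : EuclideanSpace ℝ (Fin n)) + s • u) K)
    (fun y s hs => by
      rw [one_smul, ← abs_of_pos hs, ← wedgeVol_smul hK.isCompact hK.convex
        (Eᗮ.add_mem y.2.1 huE) hs.ne', abs_of_pos hs, smul_add]
      rfl) hcont hc (by simpa only [one_smul] using h) q
  rw [momentPos_projPolar hu hEu hK]
  simp only [one_smul] at this
  exact this

/-! ### The linear shadow system K_u(t) -/

theorem reflection_orthogonal_span_apply (hu : ‖u‖ = 1) (z : EuclideanSpace ℝ (Fin n)) :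
    (Submodule.span ℝ {u})ᗮ.reflection z = z - (2 * ⟪z, u⟫) • u := by
  rw [Submodule.reflection_orthogonal_apply, Submodule.reflection_singleton_apply, hu,
    real_inner_comm, mul_smul]
  simp [two_smul]

theorem mem_reflect (hu : ‖u‖ = 1) (x : EuclideanSpace ℝ (Fin n)) :
    x ∈ reflect u K ↔ x - (2 * ⟪x, u⟫) • u ∈ K := by
  rw [← reflection_orthogonal_span_apply hu, reflect]
  constructor
  · rintro ⟨z, hz, rfl⟩
    rwa [Submodule.reflection_reflection]
  · exact fun h => ⟨_, h, Submodule.reflection_reflection _ _⟩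

theorem add_smul_mem_reflect (hu : ‖u‖ = 1) {w : EuclideanSpace ℝ (Fin n)} (hw : ⟪w, u⟫ = 0)
    (a : ℝ) : w + a • u ∈ reflect u K ↔ w + (-a) • u ∈ K := by
  rw [mem_reflect hu, inner_add_left, hw, real_inner_smul_left, real_inner_self_eq_norm_sq, hu]
  have : w + a • u - (2 * (0 + a * 1 ^ 2)) • u = w + (-a) • u := by module
  rw [this]

theorem exists_add_smul_eq (hu : ‖u‖ = 1) (x : EuclideanSpace ℝ (Fin n)) :
    ∃ w, ⟪w, u⟫ = 0 ∧ x = w + ⟪x, u⟫ • u :=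
  ⟨x - ⟪x, u⟫ • u, by
    rw [inner_sub_left, real_inner_smul_left, real_inner_self_eq_norm_sq, hu]; ring, by module⟩

theorem eq_and_eq_of_add_smul_eq (hu : ‖u‖ = 1) {w w' : EuclideanSpace ℝ (Fin n)} {c c' : ℝ}
    (hw : ⟪w, u⟫ = 0) (hw' : ⟪w', u⟫ = 0) (h : w + c • u = w' + c' • u) : w = w' ∧ c = c' := by
  have hc := congrArg (fun z => ⟪z, u⟫) h
  simp only [inner_add_left, hw, hw', real_inner_smul_left, real_inner_self_eq_norm_sq, hu] at hc
  obtain rfl : c = c' := by linarith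
  exact ⟨add_right_cancel h, rfl⟩

/-- The points of `K_u(t)` on a line parallel to `u`. -/
theorem mem_linearShadow (hu : ‖u‖ = 1) {t : ℝ} {x : EuclideanSpace ℝ (Fin n)} :
    x ∈ linearShadow u K t ↔ ∃ w, ∃ a b : ℝ, ⟪w, u⟫ = 0 ∧ w + a • u ∈ K ∧ w + b • u ∈ K ∧
      x = w + ((1 + t) / 2 * a + (t - 1) / 2 * b) • u := by
  constructor
  · rintro ⟨⟨z, r⟩, ⟨h₁, h₂⟩, rfl⟩
    obtain ⟨w, hw, hz⟩ := exists_add_smul_eq hu z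
    generalize ⟪z, u⟫ = c at hz
    subst hz
    simp only [shadowProj, Set.mem_preimage] at h₁ h₂ ⊢
    have e₁ : w + c • u - (1 * r) • u = w + (c - r) • u := by module
    have e₂ : w + c • u - (-1 * r) • u = w + (c + r) • u := by module
    rw [e₁] at h₁
    rw [e₂, add_smul_mem_reflect hu hw] at h₂
    exact ⟨w, _, _, hw, h₁, h₂, by module⟩
  · rintro ⟨w, a, b, hw, ha, hb, rfl⟩
    -- For a preimage (w + c u, r), membership of its images under T_1 and T_{-1} reads a = c - r
    -- and b = -(c + r); solving for c and r gives this point.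
    refine ⟨(w + ((a - b) / 2) • u, -(a + b) / 2), ⟨?_, ?_⟩, ?_⟩
    · simp only [shadowProj, Set.mem_preimage]
      convert! ha using 1
      module
    · simp only [shadowProj, Set.mem_preimage]
      have : w + ((a - b) / 2) • u - (-1 * (-(a + b) / 2)) • u = w + (-b) • u := by module
      rw [this, add_smul_mem_reflect hu hw, neg_neg]
      exact hb
    · simp only [shadowProj]
      module

theorem linearShadow_one (hu : ‖u‖ = 1) : linearShadow u K 1 = K := by
  ext x
  rw [mem_linearShadow hu]
  constructor
  · rintro ⟨w, a, b, -, ha, -, rfl⟩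
    convert! ha using 1
    module
  · intro hx
    obtain ⟨w, hw, h⟩ := exists_add_smul_eq hu x
    generalize ⟪x, u⟫ = c at h
    subst h
    exact ⟨w, c, c, hw, hx, hx, by module⟩

/-- Exchanging the roles of a and b in `mem_linearShadow` turns t into -t and changes the sign of
the coefficient of u. -/
theorem linearShadow_neg (hu : ‖u‖ = 1) (t : ℝ) :
    linearShadow u K (-t) = reflect u (linearShadow u K t) := by
  ext x
  obtain ⟨w, hw, h⟩ := exists_add_smul_eq hu x
  generalize ⟪x, u⟫ = c at h
  subst h
  rw [add_smul_mem_reflect hu hw, mem_linearShadow hu, mem_linearShadow hu]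
  constructor
  · rintro ⟨w', a, b, hw', ha, hb, h⟩
    obtain ⟨rfl, hc⟩ := eq_and_eq_of_add_smul_eq hu hw hw' h
    refine ⟨w, b, a, hw, hb, ha, ?_⟩
    rw [hc]
    module
  · rintro ⟨w', a, b, hw', ha, hb, h⟩
    obtain ⟨rfl, hc⟩ := eq_and_eq_of_add_smul_eq hu hw hw' h
    refine ⟨w, b, a, hw, hb, ha, ?_⟩
    rw [← neg_neg c, hc]
    module

theorem linearShadow_neg_one (hu : ‖u‖ = 1) : linearShadow u K (-1) = reflect u K := by
  rw [linearShadow_neg hu, linearShadow_one hu]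

/-- At t = 0 the coefficients are (a - b) / 2 with a, b in the same chord interval, and half the
difference set of an interval is the centred interval of the same length. -/
theorem linearShadow_zero (hu : ‖u‖ = 1) (hK : IsCompact K) (hc : Convex ℝ K) :
    linearShadow u K 0 = steiner u K := by
  ext x
  obtain ⟨w, hw, h⟩ := exists_add_smul_eq hu x
  rw [mem_linearShadow hu, steiner, Set.mem_ofPred_eq]
  generalize ⟪x, u⟫ = c at h ⊢
  subst h
  set A := {a : ℝ | w + c • u + a • u ∈ K} with hA
  have hiso : Isometry fun a : ℝ => w + c • u + a • u := Isometry.of_dist_eq fun a b => by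
    rw [dist_add_left, dist_eq_norm, ← sub_smul, norm_smul, hu, mul_one, dist_eq_norm]
  have hAc : IsCompact A := hiso.isClosedEmbedding.isCompact_preimage hK
  have hAconv : Convex ℝ A := fun a ha b hb s t hs ht hst => by
    have := hc ha hb hs ht hst
    rw [hA, Set.mem_ofPred_eq]
    convert! this using 1
    obtain rfl : t = 1 - s := by linarith
    module
  have hmem : ∀ a, a ∈ A ↔ w + (c + a) • u ∈ K := fun a => by
    rw [hA, Set.mem_ofPred_eq, add_assoc, add_smul]
  have hIcc : A.Nonempty → A = Set.Icc (sInf A) (sSup A) := fun hne =>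
    eq_Icc_of_connected_compact ⟨hne, hAconv.isPreconnected⟩ hAc
  have hvol : A.Nonempty → volume.real A = sSup A - sInf A := fun hne => by
    conv_lhs => rw [hIcc hne]
    rw [Real.volume_real_Icc_of_le]
    exact Set.nonempty_Icc.1 (hIcc hne ▸ hne)
  have hbd : A.Nonempty → ∀ a, a ∈ A ↔ sInf A ≤ a ∧ a ≤ sSup A := fun hne a =>
    Set.ext_iff.1 (hIcc hne) a
  constructor
  · rintro ⟨w', a, b, hw', ha, hb, h⟩
    obtain ⟨rfl, hc'⟩ := eq_and_eq_of_add_smul_eq hu hw hw' h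
    have ha' : a - c ∈ A := by rw [hmem, add_sub_cancel]; exact ha
    have hb' : b - c ∈ A := by rw [hmem, add_sub_cancel]; exact hb
    have hne : A.Nonempty := ⟨_, ha'⟩
    refine ⟨hne, ?_⟩
    rw [hbd hne] at ha' hb'
    rw [hvol hne, abs_le]
    constructor <;> linarith [ha'.1, ha'.2, hb'.1, hb'.2]
  · rintro ⟨hne, h⟩
    have hne : A.Nonempty := hne
    rw [hvol hne, abs_le] at h
    -- The two chord points at distance |c| on either side of the midpoint; half their signed
    -- difference is c.
    have h₁ : (sInf A + sSup A) / 2 + c ∈ A := by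
      rw [hbd hne]; constructor <;> linarith [h.1, h.2]
    have h₂ : (sInf A + sSup A) / 2 - c ∈ A := by
      rw [hbd hne]; constructor <;> linarith [h.1, h.2]
    rw [hmem] at h₁
    rw [hmem] at h₂
    exact ⟨w, _, _, hw, h₁, h₂, by module⟩

/-- The projection `T_t` as a continuous linear map. -/
def shadowProjL (u : EuclideanSpace ℝ (Fin n)) (t : ℝ) :
    EuclideanSpace ℝ (Fin n) × ℝ →L[ℝ] EuclideanSpace ℝ (Fin n) :=
  ContinuousLinearMap.fst ℝ _ _ - (t • ContinuousLinearMap.snd ℝ _ _).smulRight u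

theorem coe_shadowProjL (u : EuclideanSpace ℝ (Fin n)) (t : ℝ) :
    ⇑(shadowProjL u t) = shadowProj u t := by
  ext1 p
  simp [shadowProjL, shadowProj]

theorem isOpenMap_shadowProj (u : EuclideanSpace ℝ (Fin n)) (t : ℝ) :
    IsOpenMap (shadowProj u t) := by
  rw [← coe_shadowProjL]
  refine (shadowProjL u t).isOpenMap fun x => ⟨(x, 0), ?_⟩
  rw [coe_shadowProjL]
  simp [shadowProj]

theorem continuous_shadowProj (u : EuclideanSpace ℝ (Fin n)) (t : ℝ) :
    Continuous (shadowProj u t) := by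
  rw [← coe_shadowProjL]
  exact (shadowProjL u t).continuous

theorem convex_shadowProj_preimage {S : Set (EuclideanSpace ℝ (Fin n))} (hS : Convex ℝ S) (t : ℝ) :
    Convex ℝ (shadowProj u t ⁻¹' S) := by
  rw [← coe_shadowProjL]
  exact hS.linear_preimage (shadowProjL u t).toLinearMap

theorem convex_shadowProj_image {S : Set (EuclideanSpace ℝ (Fin n) × ℝ)} (hS : Convex ℝ S)
    (t : ℝ) : Convex ℝ (shadowProj u t '' S) := by
  rw [← coe_shadowProjL]
  exact hS.linear_image (shadowProjL u t).toLinearMap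

theorem isShadowSystem_linearShadow (hu : ‖u‖ = 1) (hK : IsConvexBody K) :
    IsShadowSystem u (linearShadow u K) := by
  have hRc : IsCompact (reflect u K) := hK.isCompact.image (LinearIsometryEquiv.continuous _)
  have hRconv : Convex ℝ (reflect u K) :=
    hK.convex.linear_image ((Submodule.span ℝ {u})ᗮ.reflection.toLinearEquiv.toLinearMap)
  set K' := shadowProj u 1 ⁻¹' K ∩ shadowProj u (-1) ⁻¹' reflect u K with hK'
  have hcl : IsClosed K' := (hK.isCompact.isClosed.preimage (continuous_shadowProj u 1)).inter
    (hRc.isClosed.preimage (continuous_shadowProj u (-1)))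
  -- A point p is recovered continuously from T_1 p and T_{-1} p: their mean is the first component,
  -- and their difference is twice the last component times u. So K' is a closed subset of a
  -- continuous image of K × R_u K.
  have hcpt : IsCompact K' := by
    refine ((hK.isCompact.prod hRc).image (f := fun p : EuclideanSpace ℝ (Fin n) × _ =>
      ((2 : ℝ)⁻¹ • (p.1 + p.2), (2 : ℝ)⁻¹ * ⟪p.2 - p.1, u⟫)) (by fun_prop)).of_isClosed_subset
      hcl ?_
    rintro ⟨z, r⟩ ⟨h₁, h₂⟩
    refine ⟨(shadowProj u 1 (z, r), shadowProj u (-1) (z, r)), ⟨h₁, h₂⟩, Prod.ext ?_ ?_⟩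
    · simp only [shadowProj]
      module
    · have : z - (-1 * r) • u - (z - (1 * r) • u) = (2 * r) • u := by module
      simp only [shadowProj]
      rw [this, real_inner_smul_left, real_inner_self_eq_norm_sq, hu]
      ring
  have hconv : Convex ℝ K' :=
    (convex_shadowProj_preimage hK.convex 1).inter (convex_shadowProj_preimage hRconv (-1))
  refine ⟨fun t => ⟨hcpt.image (continuous_shadowProj u t), convex_shadowProj_image hconv t, ?_⟩,
    K', hcpt, hconv, fun t => rfl⟩
  obtain ⟨x, hx⟩ := hK.nonempty_interior
  obtain ⟨w, hw, h⟩ := exists_add_smul_eq hu x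
  generalize ⟪x, u⟫ = c at h
  subst h
  set V := shadowProj u 1 ⁻¹' interior K ∩ shadowProj u (-1) ⁻¹' reflect u (interior K) with hV
  have hRo : IsOpen (reflect u (interior K)) :=
    (Submodule.span ℝ {u})ᗮ.reflection.toHomeomorph.isOpenMap _ isOpen_interior
  have hVo : IsOpen V := (isOpen_interior.preimage (continuous_shadowProj u 1)).inter
    (hRo.preimage (continuous_shadowProj u (-1)))
  have hVK : V ⊆ K' := Set.inter_subset_inter (Set.preimage_mono interior_subset)
    (Set.preimage_mono (Set.image_mono interior_subset))
  -- T_1 sends (w, -c) to the interior point w + c u of K, and T_{-1} sends it to the reflection w -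
  -- c u. As T_t is open, the image of V is an open subset of K_u(t).
  have hmem : (w, -c) ∈ V := by
    constructor
    · simp only [shadowProj, Set.mem_preimage]
      convert! hx using 1
      module
    · simp only [shadowProj, Set.mem_preimage]
      have : w - (-1 * -c) • u = w + (-c) • u := by module
      rw [this, add_smul_mem_reflect hu hw, neg_neg]
      exact hx
  exact ⟨_, interior_maximal (Set.image_mono hVK) (isOpenMap_shadowProj u t _ hVo)
    (Set.mem_image_of_mem _ hmem)⟩

/-! ### Reflection invariance and convexity along a shadow system -/

theorem orthogonalProjectionOnto_sub_smul (hEu : E ≤ (Submodule.span ℝ {u})ᗮ)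
    (z : EuclideanSpace ℝ (Fin n)) (a : ℝ) :
    E.orthogonalProjectionOnto (z - a • u) = E.orthogonalProjectionOnto z := by
  rw [map_sub, map_smul, Submodule.orthogonalProjectionOnto_eq_zero_iff.2
    (mem_orthogonal_of_le_orthogonal_span hEu), smul_zero, sub_zero]

theorem wedgeVol_reflect (hu : ‖u‖ = 1) (hEu : E ≤ (Submodule.span ℝ {u})ᗮ) (hK : IsCompact K)
    {y : EuclideanSpace ℝ (Fin n)} (hy : y ∈ Eᗮ ⊓ (Submodule.span ℝ {u})ᗮ) (s : ℝ) :
    wedgeVol E (y + s • u) (reflect u K) = wedgeVol E (y + (-s) • u) K := by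
  have huE := mem_orthogonal_of_le_orthogonal_span hEu
  have hR : IsCompact (reflect u K) := hK.image (LinearIsometryEquiv.continuous _)
  rw [wedgeVol_eq_measureReal_image (Eᗮ.add_mem hy.1 (Eᗮ.smul_mem _ huE)) hR,
    wedgeVol_eq_measureReal_image (Eᗮ.add_mem hy.1 (Eᗮ.smul_mem _ huE)) hK, reflect,
    Set.image_image]
  congr 2
  funext z
  rw [reflection_orthogonal_span_apply hu, orthogonalProjectionOnto_sub_smul hEu]
  congr 1
  simp only [innerSL_apply_apply, inner_add_left, inner_sub_right, inner_smul_right,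
    real_inner_smul_left, inner_eq_zero_of_mem_inf hy, real_inner_self_eq_norm_sq, hu]
  rw [real_inner_comm z u]
  ring

/-- Reflecting K changes the height s to -s, which the central symmetry of L_E(K) undoes. -/
theorem sectionVol_reflect (hu : ‖u‖ = 1) (hEu : E ≤ (Submodule.span ℝ {u})ᗮ) (hK : IsCompact K)
    (hc : Convex ℝ K) (s : ℝ) : sectionVol E u s (reflect u K) = sectionVol E u s K := by
  rw [← sectionVol_neg hEu hK hc]
  unfold sectionVol projPolarSection
  congr 2
  ext y
  rw [wedgeVol_reflect hu hEu hK y.2]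

/-- All the volumes are those of images of the one set K' under maps (P_E z, ℓ p (z, r)), where p =
(y, t) enters only the functional `ℓ p`, and affinely. The seminorm estimate over K' then gives
joint convexity. -/
theorem convexOn_wedgeVol_shadow (hu : ‖u‖ = 1) (hEu : E ≤ (Submodule.span ℝ {u})ᗮ)
    {K' : Set (EuclideanSpace ℝ (Fin n) × ℝ)} (hK : IsCompact K') (hc : Convex ℝ K') :
    ConvexOn ℝ Set.univ
      fun p : (Eᗮ ⊓ (Submodule.span ℝ {u})ᗮ : Submodule ℝ (EuclideanSpace ℝ (Fin n))) × ℝ =>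
        wedgeVol E ((p.1 : EuclideanSpace ℝ (Fin n)) + u) (shadowProj u p.2 '' K') := by
  have huE := mem_orthogonal_of_le_orthogonal_span hEu
  let ℓ : (Eᗮ ⊓ (Submodule.span ℝ {u})ᗮ : Submodule ℝ (EuclideanSpace ℝ (Fin n))) × ℝ →
      (EuclideanSpace ℝ (Fin n) × ℝ →L[ℝ] ℝ) := fun p =>
    (innerSL ℝ ((p.1 : EuclideanSpace ℝ (Fin n)) + u)).comp (ContinuousLinearMap.fst ℝ _ _) -
      p.2 • ContinuousLinearMap.snd ℝ _ _
  have key : ∀ p : (Eᗮ ⊓ (Submodule.span ℝ {u})ᗮ : Submodule ℝ (EuclideanSpace ℝ (Fin n))) × ℝ,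
      wedgeVol E ((p.1 : EuclideanSpace ℝ (Fin n)) + u) (shadowProj u p.2 '' K') =
      ((lebesgueOn E).prod volume).real ((fun q => (E.orthogonalProjectionOnto.comp
        (ContinuousLinearMap.fst ℝ _ ℝ) q, ℓ p q)) '' K') := by
    rintro ⟨y, t⟩
    rw [wedgeVol_eq_measureReal_image (Eᗮ.add_mem y.2.1 huE)
      (hK.image (continuous_shadowProj u t)), Set.image_image]
    congr 2
    funext q
    simp only [shadowProj, orthogonalProjectionOnto_sub_smul hEu]
    refine Prod.ext rfl ?_
    simp only [ℓ, innerSL_apply_apply, inner_add_left, inner_sub_right, inner_smul_right,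
      inner_eq_zero_of_mem_inf y.2, real_inner_self_eq_norm_sq, hu,
      sub_apply, ContinuousLinearMap.comp_apply,
      smul_apply, ContinuousLinearMap.coe_fst', ContinuousLinearMap.coe_snd',
      smul_eq_mul]
    ring
  refine ⟨convex_univ, fun p _ q _ a b ha hb hab => ?_⟩
  have := measureReal_image_prodMk_add_smul_le (lebesgueOn E)
    (E.orthogonalProjectionOnto.comp (ContinuousLinearMap.fst ℝ _ ℝ)) hK hc (ℓ p) (ℓ q) a b
  rw [abs_of_nonneg ha, abs_of_nonneg hb] at this
  -- `ℓ` is affine rather than linear because of the fixed summand u, hence the use of a + b = 1.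
  have hℓ : a • ℓ p + b • ℓ q = ℓ (a • p + b • q) := by
    have hb' : b = 1 - a := by linarith
    refine ContinuousLinearMap.ext fun z => ?_
    simp [ℓ, hb']
    ring
  rw [hℓ] at this
  dsimp only
  rw [key, key, key]
  exact this

theorem convexOn_momentPos_shadow (hu : ‖u‖ = 1) (hEu : E ≤ (Submodule.span ℝ {u})ᗮ)
    {K : ℝ → Set (EuclideanSpace ℝ (Fin n))} (hK : IsShadowSystem u K) {k : ℕ} (hk : 1 ≤ k) :
    ConvexOn ℝ Set.univ
      (fun t : ℝ => (momentPos k u E (projPolar E (K t))) ^ (-1 / (k : ℝ))) := by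
  obtain ⟨hb, K', hK', hc, h⟩ := hK
  have hφ := convexOn_wedgeVol_shadow hu hEu hK' hc
  simp only [← h] at hφ
  have := (convexOn_integral_inv_pow_euclidean (k := k) (by omega) hφ fun t =>
    exists_mul_one_add_norm_le_wedgeVol hu hEu (hb t)).smul (c := (↑(finrank ℝ
      (Eᗮ ⊓ (Submodule.span ℝ {u})ᗮ : Submodule ℝ (EuclideanSpace ℝ (Fin n))) + k) : ℝ)⁻¹ ^
        (-1 / (k : ℝ))) (by positivity)
  convert! this using 2 with t
  rw [momentPos_projPolar_eq_integral_inv_pow hu hEu (hb t) hk, Real.mul_rpow (by positivity)]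
  · rfl
  · exact integral_nonneg fun y => inv_nonneg.2 (pow_nonneg (wedgeVol_nonneg _) _)

theorem momentPos_projPolar_pos (hu : ‖u‖ = 1) (hEu : E ≤ (Submodule.span ℝ {u})ᗮ)
    (hK : IsConvexBody K) {k : ℕ} (hk : 1 ≤ k) : 0 < momentPos k u E (projPolar E K) := by
  have huE := mem_orthogonal_of_le_orthogonal_span hEu
  obtain ⟨c, hc, h⟩ := exists_mul_one_add_norm_le_wedgeVol hu hEu hK
  rw [momentPos_projPolar_eq_integral_inv_pow hu hEu hK hk]
  have hcont : Continuous fun y : (Eᗮ ⊓ (Submodule.span ℝ {u})ᗮ : Submodule ℝ _) =>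
      wedgeVol E ((y : EuclideanSpace ℝ (Fin n)) + u) K :=
    (continuous_wedgeVol hK.isCompact hK.convex).comp
      (f := fun y : (Eᗮ ⊓ (Submodule.span ℝ {u})ᗮ : Submodule ℝ _) =>
        (⟨y + u, Eᗮ.add_mem y.2.1 huE⟩ : Eᗮ)) (by fun_prop)
  have := integral_inv_pow_pos (lebesgueOn (Eᗮ ⊓ (Submodule.span ℝ {u})ᗮ)) hcont hc h
    (p := finrank ℝ (Eᗮ ⊓ (Submodule.span ℝ {u})ᗮ : Submodule ℝ (EuclideanSpace ℝ (Fin n))) + k)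
    (by omega)
  refine mul_pos (inv_pos.2 ?_) this
  exact_mod_cast (by omega)

end ShadowSystems

end

theorem theorem4p3 {n k : ℕ} (hk : 1 ≤ k) (u : EuclideanSpace ℝ (Fin n)) (hu : ‖u‖ = 1)
    (E : Submodule ℝ (EuclideanSpace ℝ (Fin n))) (hEu : E ≤ (Submodule.span ℝ {u})ᗮ)
    (hE : finrank ℝ E = k - 1) :
    (∀ K : Set (EuclideanSpace ℝ (Fin n)), IsConvexBody K →
      IsShadowSystem u (linearShadow u K) ∧
      linearShadow u K 1 = K ∧
      linearShadow u K 0 = steiner u K ∧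
      linearShadow u K (-1) = reflect u K ∧
      (∀ t : ℝ,
        IntegrableOn (fun x : Eᗮ => |⟪(x : EuclideanSpace ℝ (Fin n)), u⟫| ^ (k - 1))
          (projPolar E (linearShadow u K t)) (lebesgueOn Eᗮ) ∧
        0 < moment k u E (projPolar E (linearShadow u K t)) ∧
        moment k u E (projPolar E (linearShadow u K t)) =
          ∫ s : ℝ, |s| ^ (k - 1) * sectionVol E u s (linearShadow u K t)) ∧
      ConvexOn ℝ Set.univ
        (fun t : ℝ => (moment k u E (projPolar E (linearShadow u K t))) ^ (-1 / (k : ℝ))) ∧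
      Function.Even
        (fun t : ℝ => (moment k u E (projPolar E (linearShadow u K t))) ^ (-1 / (k : ℝ)))) ∧
    (∀ K : ℝ → Set (EuclideanSpace ℝ (Fin n)), IsShadowSystem u K →
      (∀ t : ℝ,
        IntegrableOn (fun x : Eᗮ => ⟪(x : EuclideanSpace ℝ (Fin n)), u⟫ ^ (k - 1))
          (positivePart u E (projPolar E (K t))) (lebesgueOn Eᗮ) ∧
        0 < momentPos k u E (projPolar E (K t)) ∧
        momentPos k u E (projPolar E (K t)) =
          ∫ s in Set.Ioi (0 : ℝ), s ^ (k - 1) * sectionVol E u s (K t)) ∧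
      ConvexOn ℝ Set.univ
        (fun t : ℝ => (momentPos k u E (projPolar E (K t))) ^ (-1 / (k : ℝ)))) := by
  have hk0 : (0 : ℝ) < k := by exact_mod_cast hk
  refine ⟨fun K hK => ?_, fun K hK => ⟨fun t => ⟨?_, momentPos_projPolar_pos hu hEu (hK.1 t) hk,
    momentPos_projPolar hu hEu (hK.1 t) k⟩, convexOn_momentPos_shadow hu hEu hK hk⟩⟩
  · have hS := isShadowSystem_linearShadow hu hK
    refine ⟨hS, linearShadow_one hu, linearShadow_zero hu hK.isCompact hK.convex,
      linearShadow_neg_one hu, fun t => ⟨integrableOn_projPolar_abs_inner_pow (hS.1 t) _, ?_,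
        moment_projPolar hu hEu (hS.1 t) k⟩, ?_, fun t => ?_⟩
    · rw [moment_eq_two_mul_momentPos hu hEu (hS.1 t)]
      exact mul_pos two_pos (momentPos_projPolar_pos hu hEu (hS.1 t) hk)
    -- The factor 2 between the moments becomes the positive constant 2^(-1/k).
    · have := (convexOn_momentPos_shadow hu hEu hS hk).smul (c := (2 : ℝ) ^ (-1 / (k : ℝ)))
        (by positivity)
      convert! this using 2 with t
      rw [moment_eq_two_mul_momentPos hu hEu (hS.1 t), Real.mul_rpow two_pos.le
        (momentPos_projPolar_pos hu hEu (hS.1 t) hk).le, smul_eq_mul]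
    · dsimp only
      rw [moment_projPolar hu hEu (hS.1 t), moment_projPolar hu hEu (hS.1 (-t)),
        linearShadow_neg hu]
      simp only [sectionVol_reflect hu hEu (hS.1 t).isCompact (hS.1 t).convex]
  · exact (integrableOn_projPolar_inner_pow (hK.1 t) _).mono_set fun x hx => hx.1
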